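/- Let $\Bbbk$ be an algebraically closed field of characteristic zero, $G$ a finite group, $g$ a central element of $G$, $\chi:G\to\Bbbk^\times$ a linear character, $n$ the order of $\chi(g)$, and $\mu\in\Bbbk$ with $\mu(g^n-1)=0$ in $\Bbbk G$ (a group datum of nilpotent type). Assume $n\ge 2$. Let $H$ be the associated algebra (the underlying algebra of the pointed rank one Hopf algebra of nilpotent type), i.e. the $\Bbbk$-algebra generated by $y$ and the elements of $G$, subject to the relations of $\Bbbk G$ and $$y^n=\mu(g^n-1),\qquad yh=\chi(h)\,hy\quad(h\in G).$$ Let $J$ be the Jacobson radical of $H$. Let $V_1,\dots,V_m$ be a complete set of pairwise non-isomorphic simple $\Bbbk G$-modules, viewed also as $H$-modules with $y$ acting by $0$. For $1\le i\le m$ and $1\le j\le n$ let $M(i,j)=V_i\oplus xV_i\oplus\cdots\oplus x^{j-1}V_i$ be the $H$-module with $$h(x^kv)=\chi(h)^{-k}x^k(hv)\ (h\in G),\qquad y(x^kv)=x^{k+1}v\ (0\le k\le j-2),\qquad y(x^{j-1}v)=0 .$$ There is a unique permutation $\tau$ of $\{1,\dots,m\}$ with $V_{\chi^{-1}}\otimes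 V_i\cong V_i\otimes V_{\chi^{-1}}\cong V_{\tau(i)}$ as $\Bbbk G$-modules for all $i$, where $V_{\chi^{-1}}$ is the one-dimensional module with character $\chi^{-1}$. Moreover, for $1\le i\le m$ and $1\le j\le n$: 1. The radical (the intersection of the maximal submodules) of $M(i,j)$ equals $JM(i,j)$; $JM(i,1)=0$, and $JM(i,j)\cong M(\tau(i),j-1)$ for $2\le j\le n$. 2. $\operatorname{soc}M(i,j)\cong V_{\tau^{j-1}(i)}$, $M(i,j)/JM(i,j)\cong V_i$, and the projective cover of $M(i,j)$ is isomorphic to $M(i,n)$. 3. $M(i,j)$ is indecomposable and uniserial. $H$ is a Nakayama algebra (it is finite-dimensional, and every finitely generated indecomposable left $H$-module that is projective or injective is uniserial), and it is of finite representation type. 4. $M(i,j)\cong M(k,l)$ if and only if $i=k$ and $j=l$ (for $1\le i,k\le m$, $1\le j,l\le n$). The modules $M(i,j)$ are finite-dimensional, and every finite-dimensional indecomposable $H$-module is isomorphic to some $M(i,j)$. -/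

import Mathlib

universe u v w

/-! ## Module-theoretic notions -/

/-- A module is indecomposable if it is nonzero and is not the direct sum of two nonzero
submodules. -/
def IsIndecomposableModule (R : Type*) [Ring R] (M : Type*) [AddCommGroup M] [Module R M] : Prop :=
  Nontrivial M ∧ ∀ N N' : Submodule R M, IsCompl N N' → N = ⊥ ∨ N' = ⊥

/-- A module is uniserial if its submodules form a chain. -/
def IsUniserialModule (R : Type*) [Ring R] (M : Type*) [AddCommGroup M] [Module R M] : Prop :=
  ∀ N N' : Submodule R M, N ≤ N' ∨ N' ≤ N

/-- The submodule `J M`, where `J` is the Jacobson radical of the ring. -/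
def radicalSubmodule (R : Type*) [Ring R] (M : Type*) [AddCommGroup M] [Module R M] :
    Submodule R M :=
  Ring.jacobson R • (⊤ : Submodule R M)

/-- The socle of a module: the sum of its simple submodules. -/
def socleSubmodule (R : Type*) [Ring R] (M : Type*) [AddCommGroup M] [Module R M] :
    Submodule R M :=
  sSup {N : Submodule R M | IsSimpleModule R N}

/-- `π : P → M` is a projective cover: `P` is projective, `π` is surjective, and the kernel of `π`
is superfluous. -/
def IsProjectiveCover {R : Type*} [Ring R] {P M : Type*} [AddCommGroup P] [Module R P]
    [AddCommGroup M] [Module R M] (π : P →ₗ[R] M) : Prop :=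
  Module.Projective R P ∧ Function.Surjective π ∧
    ∀ N : Submodule R P, N ⊔ LinearMap.ker π = ⊤ → N = ⊤

/-- A Nakayama algebra over a field: a finite-dimensional algebra all of whose finitely generated
indecomposable projective and finitely generated indecomposable injective left modules are
uniserial. -/
def IsNakayamaAlgebra (k : Type*) [Field k] (A : Type u) [Ring A] [Algebra k A] : Prop :=
  FiniteDimensional k A ∧
    (∀ (P : Type u) [AddCommGroup P] [Module A P], Module.Finite A P → Module.Projective A P →
      IsIndecomposableModule A P → IsUniserialModule A P) ∧
    (∀ (E : Type u) [AddCommGroup E] [Module A E], Module.Finite A E → Module.Injective A E →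
      IsIndecomposableModule A E → IsUniserialModule A E)

/-- A finite-dimensional algebra is of finite representation type if it has only finitely many
finitely generated indecomposable modules up to isomorphism. -/
def IsFiniteRepresentationType (k : Type*) [Field k] (A : Type u) [Ring A] [Algebra k A] : Prop :=
  FiniteDimensional k A ∧
    ∃ (N : ℕ) (L : Fin N → ModuleCat.{u} A),
      ∀ (M : Type u) [AddCommGroup M] [Module A M], Module.Finite A M →
        IsIndecomposableModule A M → ∃ s, Nonempty (M ≃ₗ[A] L s)

/-! ## Linear characters -/

/-- The one-dimensional representation `V_ψ` attached to a linear character `ψ`. -/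
def linearCharacterRep {k : Type u} {G : Type v} [Field k] [Group G] (ψ : G →* kˣ) :
    Representation k G k where
  toFun h := (ψ h : k) • LinearMap.id
  map_one' := by ext; simp
  map_mul' a b := by ext; simp [mul_comm]

/-! ## Group data and the algebra attached to a group datum -/

/-- A group datum `(G, χ, g, μ)` over `k`: `χ` is a linear character of `G`, `g` is central in `G`,
and `χ ^ n = 1` or `μ (g ^ n - 1) = 0` (in `kG`), where `n` is the order of `χ g`. -/
structure GroupDatum (k : Type u) (G : Type v) [Field k] [Group G] where
  χ : G →* kˣ
  g : G
  g_central : g ∈ Subgroup.center G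
  μ : k
  compat : χ ^ orderOf (χ g) = 1 ∨
    μ • ((MonoidAlgebra.of k G g) ^ orderOf (χ g) - 1 : MonoidAlgebra k G) = 0

namespace GroupDatum

variable {k : Type u} {G : Type v} [Field k] [Group G]

/-- The order `n` of `χ g`. -/
noncomputable def n (D : GroupDatum k G) : ℕ := orderOf (D.χ D.g)

/-- The datum is of nilpotent type if `μ (g ^ n - 1) = 0` in `kG`. -/
def IsNilpotentType (D : GroupDatum k G) : Prop :=
  D.μ • ((MonoidAlgebra.of k G D.g) ^ D.n - 1 : MonoidAlgebra k G) = 0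

/-- The generator `h ∈ G` of the free algebra on `G ⊔ {y}`. -/
noncomputable def freeG (_D : GroupDatum k G) (h : G) : FreeAlgebra k (Option G) :=
  FreeAlgebra.ι k (some h)

/-- The generator `y` of the free algebra on `G ⊔ {y}`. -/
noncomputable def freeY (_D : GroupDatum k G) : FreeAlgebra k (Option G) :=
  FreeAlgebra.ι k none

/-- The defining relations of `H_D`: those of `kG`, together with `y ^ n = μ (g ^ n - 1)` and
`y h = χ(h) h y`. -/
inductive Rel (D : GroupDatum k G) : FreeAlgebra k (Option G) → FreeAlgebra k (Option G) → Prop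
  | one : Rel D (D.freeG 1) 1
  | mul (a b : G) : Rel D (D.freeG (a * b)) (D.freeG a * D.freeG b)
  | pow : Rel D (D.freeY ^ D.n) (D.μ • (D.freeG D.g ^ D.n - 1))
  | comm (h : G) : Rel D (D.freeY * D.freeG h) ((D.χ h : k) • (D.freeG h * D.freeY))

/-- The algebra `H_D` generated by `y` and the elements of `G`. -/
abbrev H (D : GroupDatum k G) : Type (max u v) := RingQuot D.Rel

/-- The element `h ∈ G` of `H_D`. -/
noncomputable def ofG (D : GroupDatum k G) (h : G) : D.H := RingQuot.mkAlgHom k D.Rel (D.freeG h)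

/-- The element `y` of `H_D`. -/
noncomputable def y (D : GroupDatum k G) : D.H := RingQuot.mkAlgHom k D.Rel D.freeY

/-- If `D` is of nilpotent type, a representation `ρ` of `G` on `W` and an endomorphism `Y` of `W`
with `Y ^ n = 0` and `Y ρ(h) = χ(h) ρ(h) Y` define an action of `H_D` on `W`. -/
noncomputable def action (D : GroupDatum k G) (hD : D.IsNilpotentType)
    {W : Type w} [AddCommGroup W] [Module k W] (ρ : Representation k G W) (Y : Module.End k W)
    (hY : Y ^ D.n = 0) (hc : ∀ h, Y * ρ h = (D.χ h : k) • (ρ h * Y)) :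
    D.H →ₐ[k] Module.End k W :=
  RingQuot.liftAlgHom k ⟨FreeAlgebra.lift k (fun s => s.elim Y (fun h => ρ h)), by
    intro a b hab
    induction hab with
    | one => simp [freeG]
    | mul a b => simp [freeG]
    | pow =>
      have := congrArg ρ.asAlgebraHom hD
      simp only [map_smul, map_sub, map_pow, map_one, map_zero, MonoidAlgebra.of_apply,
        Representation.asAlgebraHom_single, one_smul] at this
      simpa [freeG, freeY, hY] using this.symm
    | comm h => simpa [freeG, freeY] using hc h⟩

theorem action_ofG (D : GroupDatum k G) (hD : D.IsNilpotentType)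
    {W : Type w} [AddCommGroup W] [Module k W] (ρ : Representation k G W) (Y : Module.End k W)
    (hY : Y ^ D.n = 0) (hc : ∀ h, Y * ρ h = (D.χ h : k) • (ρ h * Y)) (h : G) :
    D.action hD ρ Y hY hc (D.ofG h) = ρ h := by
  simp [action, ofG, freeG]

theorem action_y (D : GroupDatum k G) (hD : D.IsNilpotentType)
    {W : Type w} [AddCommGroup W] [Module k W] (ρ : Representation k G W) (Y : Module.End k W)
    (hY : Y ^ D.n = 0) (hc : ∀ h, Y * ρ h = (D.χ h : k) • (ρ h * Y)) :
    D.action hD ρ Y hY hc D.y = Y := by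
  simp [action, y, freeY]

/-! ### A `kG`-module viewed as an `H_D`-module with `y` acting by zero -/

/-- The `H_D`-module obtained from a `kG`-module `V` by letting `y` act by zero. -/
@[nolint unusedArguments]
def Infl (D : GroupDatum k G) (_hD : D.IsNilpotentType) (_hn : 2 ≤ D.n)
    {V : Type w} [AddCommGroup V] [Module k V] (_ρ : Representation k G V) : Type w := V

section Infl

variable (D : GroupDatum k G) (hD : D.IsNilpotentType) (hn : 2 ≤ D.n)
  {V : Type w} [AddCommGroup V] [Module k V] (ρ : Representation k G V)

instance : AddCommGroup (D.Infl hD hn ρ) := inferInstanceAs (AddCommGroup V)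

instance : Module k (D.Infl hD hn ρ) := inferInstanceAs (Module k V)

/-- The action of `H_D` on an inflated `kG`-module. -/
noncomputable def inflAction : D.H →ₐ[k] Module.End k V :=
  D.action hD ρ 0 (zero_pow (by omega)) (fun h => by simp)

noncomputable instance : Module D.H (D.Infl hD hn ρ) :=
  Module.compHom V (D.inflAction hD hn ρ).toRingHom

instance : IsScalarTower k D.H (D.Infl hD hn ρ) where
  smul_assoc c a v := by
    change (D.inflAction hD hn ρ (c • a) : Module.End k V) v =
      c • (D.inflAction hD hn ρ a : Module.End k V) v
    rw [map_smul]
    rfl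

end Infl

/-! ### The modules `M(V, j) = V ⊕ xV ⊕ ⋯ ⊕ x^{j-1}V` -/

/-- The `kG`-module `V ⊕ xV ⊕ ⋯ ⊕ x^{j-1}V`, where `h (x^l v) = χ(h)^{-l} x^l (h v)`. A function
`f : Fin j → V` stands for the element `∑ l, x^l f(l)`. -/
noncomputable def stringRep (D : GroupDatum k G) {V : Type w} [AddCommGroup V] [Module k V]
    (ρ : Representation k G V) (j : ℕ) : Representation k G (Fin j → V) where
  toFun h := LinearMap.pi fun l =>
    (((D.χ h)⁻¹ ^ (l : ℕ) : kˣ) : k) • (ρ h ∘ₗ LinearMap.proj l)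
  map_one' := by ext; simp
  map_mul' a b := by
    refine LinearMap.ext fun f => funext fun l => ?_
    simp [mul_pow, smul_smul, mul_comm]

/-- The action of `y` on `V ⊕ xV ⊕ ⋯ ⊕ x^{j-1}V`: `y (x^l v) = x^{l+1} v` for `l + 1 < j`, and
`y (x^{j-1} v) = 0`. -/
def stringShift (k : Type u) [Field k] (V : Type w) [AddCommGroup V] [Module k V] (j : ℕ) :
    Module.End k (Fin j → V) where
  toFun f l := if h : (l : ℕ) = 0 then 0 else f ⟨(l : ℕ) - 1, by omega⟩
  map_add' f f' := by ext l; by_cases h : (l : ℕ) = 0 <;> simp [h]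
  map_smul' c f := by ext l; by_cases h : (l : ℕ) = 0 <;> simp [h]

theorem stringShift_apply (V : Type w) [AddCommGroup V] [Module k V] (j : ℕ) (f : Fin j → V)
    (l : Fin j) : stringShift k V j f l = if h : (l : ℕ) = 0 then 0 else f ⟨(l : ℕ) - 1, by omega⟩ :=
  rfl

theorem stringShift_pow_apply (V : Type w) [AddCommGroup V] [Module k V] (j t : ℕ)
    (f : Fin j → V) (l : Fin j) :
    (stringShift k V j ^ t) f l = if h : (l : ℕ) < t then 0 else f ⟨(l : ℕ) - t, by omega⟩ := by
  induction t generalizing l with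
  | zero => simp
  | succ t ih =>
    rw [pow_succ', Module.End.mul_apply, stringShift_apply]
    by_cases h : (l : ℕ) = 0
    · simp [h]
    · rw [dif_neg h, ih]
      by_cases h' : (l : ℕ) < t + 1
      · rw [dif_pos h', dif_pos (by simp only; omega)]
      · rw [dif_neg h', dif_neg (by simp only; omega)]
        congr 2
        simp only
        omega

theorem stringShift_pow_eq_zero (V : Type w) [AddCommGroup V] [Module k V] {j t : ℕ}
    (hj : j ≤ t) : stringShift k V j ^ t = 0 := by
  refine LinearMap.ext fun f => funext fun l => ?_
  rw [stringShift_pow_apply, dif_pos (lt_of_lt_of_le l.2 hj)]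
  rfl

theorem stringShift_comm (D : GroupDatum k G) {V : Type w} [AddCommGroup V] [Module k V]
    (ρ : Representation k G V) (j : ℕ) (h : G) :
    stringShift k V j * D.stringRep ρ j h =
      (D.χ h : k) • (D.stringRep ρ j h * stringShift k V j) := by
  refine LinearMap.ext fun f => funext fun l => ?_
  by_cases hl : (l : ℕ) = 0
  · simp [stringShift_apply, stringRep, hl]
  · obtain ⟨m, hm⟩ := Nat.exists_eq_succ_of_ne_zero hl
    simp [stringShift_apply, stringRep, hm, smul_smul, pow_succ, mul_comm]

/-- The `H_D`-module `M(V, j) = V ⊕ xV ⊕ ⋯ ⊕ x^{j-1}V` for `j ≤ n`. -/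
@[nolint unusedArguments]
def M (D : GroupDatum k G) (_hD : D.IsNilpotentType) {V : Type w} [AddCommGroup V] [Module k V]
    (_ρ : Representation k G V) (j : ℕ) (_hj : j ≤ D.n) : Type w := Fin j → V

section M

variable (D : GroupDatum k G) (hD : D.IsNilpotentType)
  {V : Type w} [AddCommGroup V] [Module k V] (ρ : Representation k G V) (j : ℕ) (hj : j ≤ D.n)

instance : AddCommGroup (D.M hD ρ j hj) := inferInstanceAs (AddCommGroup (Fin j → V))

instance : Module k (D.M hD ρ j hj) := inferInstanceAs (Module k (Fin j → V))

/-- The action of `H_D` on `M(V, j)`. -/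
noncomputable def stringAction : D.H →ₐ[k] Module.End k (Fin j → V) :=
  D.action hD (D.stringRep ρ j) (stringShift k V j) (stringShift_pow_eq_zero V hj)
    (D.stringShift_comm ρ j)

noncomputable instance : Module D.H (D.M hD ρ j hj) :=
  Module.compHom (Fin j → V) (D.stringAction hD ρ j hj).toRingHom

instance : IsScalarTower k D.H (D.M hD ρ j hj) where
  smul_assoc c a v := by
    change (D.stringAction hD ρ j hj (c • a) : Module.End k (Fin j → V)) v =
      c • (D.stringAction hD ρ j hj a : Module.End k (Fin j → V)) v
    rw [map_smul]
    rfl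

end M

end GroupDatum

/-! The element `y` is nilpotent and commutes with `G` up to scalars, so `yX` is a submodule of
every module `X`. Hence `y` kills all simple modules and lies in the Jacobson radical
(`y_mem_jacobson`).

Inside `M(V, j)` with `V` simple, let `F_a` be the span of the degrees `≥ a`. The leading
coefficients in degree `a` of a submodule's elements in `F_a` form a `G`-stable subspace of `V`,
hence `0` or `V`, and multiplication by `y` carries them upwards. So the `F_a` are the only
submodules (`exists_eq_filtration`). This gives uniseriality, the radical `F_1` and the socle
`F_{j-1}`. Shifting degrees by `a` turns `F_a` into an `M(W, j - a)` with `W` the twist of `V` by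
`χ^{-a}`, which is where `τ` comes from. The top and the dimension recover `i` and `j`.

The other ingredient is averaging over `G` in characteristic zero. Equivariant lifts of `V` make
`M(V, n)` projective, since `y^n = 0` leaves no further relation to check. For an indecomposable `X`
with `t` minimal such that `y^t X = 0`, Maschke gives a simple `V_i` in `X` meeting `ker y^{t-1}`
trivially, hence a map `M(V_i, t) → X`. An averaged retraction of `y^{t-1}` on `V_i` gives a map
back, and the composite is triangular with identity diagonal. So `M(V_i, t)` splits off and equals
`X` (`exists_equiv_M`). The Nakayama property and finite representation type follow. -/

namespace Representation

/-! ### Irreducible representations, averaging and Maschke's theorem -/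

section

variable {k : Type*} {G : Type*} {V W X : Type*} [Field k] [Group G]
  [AddCommGroup V] [Module k V] [AddCommGroup W] [Module k W] [AddCommGroup X] [Module k X]

theorem isIrreducible_iff_invariant (ρ : Representation k G V) :
    ρ.IsIrreducible ↔ Nontrivial V ∧
      ∀ p : Submodule k V, (∀ h, ∀ v ∈ p, ρ h v ∈ p) → p = ⊥ ∨ p = ⊤ := by
  constructor
  · intro H
    refine ⟨?_, fun p hp => ?_⟩
    · by_contra hV
      rw [not_nontrivial_iff_subsingleton] at hV
      exact (bot_ne_top (α := Subrepresentation ρ))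
        (Subrepresentation.toSubmodule_injective (Subsingleton.elim _ _))
    · exact (H.eq_bot_or_eq_top ⟨p, fun h v hv => hp h v hv⟩).imp
        (congrArg Subrepresentation.toSubmodule) (congrArg Subrepresentation.toSubmodule)
  · rintro ⟨hV, H⟩
    exact
      { exists_pair_ne := ⟨⊥, ⊤, fun h =>
          bot_ne_top (α := Submodule k V) (congrArg Subrepresentation.toSubmodule h)⟩
        eq_bot_or_eq_top := fun s =>
          (H s.toSubmodule fun h v hv => s.apply_mem_toSubmodule h hv).imp
            (fun h => Subrepresentation.toSubmodule_injective h)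
            (fun h => Subrepresentation.toSubmodule_injective h) }

/-- The orbit of a nonzero vector is finite and spans a nonzero stable subspace. -/
theorem IsIrreducible.finiteDimensional [Finite G] {ρ : Representation k G V}
    (hρ : ρ.IsIrreducible) : FiniteDimensional k V := by
  obtain ⟨_, H⟩ := (isIrreducible_iff_invariant ρ).1 hρ
  obtain ⟨v, hv⟩ := exists_ne (0 : V)
  have hfin : (Set.range fun h => ρ h v).Finite := Set.finite_range _
  rcases H (Submodule.span k (Set.range fun h => ρ h v)) (by
    intro h w hw
    induction hw using Submodule.span_induction with
    | mem x hx =>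
      obtain ⟨a, rfl⟩ := hx
      exact Submodule.subset_span ⟨h * a, by simp⟩
    | zero => simp
    | add x y _ _ hx hy => simpa using add_mem hx hy
    | smul c x _ hx => simpa using Submodule.smul_mem _ c hx) with h | h
  · exact absurd ((Submodule.eq_bot_iff _).1 h v (Submodule.subset_span ⟨1, by simp⟩)) hv
  · exact ⟨h ▸ Submodule.fg_span hfin⟩

/-- The average over the group of a linear map between representations. -/
noncomputable def average [Fintype G] (ρ : Representation k G V) (σ : Representation k G W)
    (L : V →ₗ[k] W) : V →ₗ[k] W :=
  (Fintype.card G : k)⁻¹ • ∑ h : G, σ h⁻¹ ∘ₗ L ∘ₗ ρ h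

section average

variable [Fintype G] (ρ : Representation k G V) (σ : Representation k G W)

theorem average_apply (L : V →ₗ[k] W) (v : V) :
    average ρ σ L v = (Fintype.card G : k)⁻¹ • ∑ h : G, σ h⁻¹ (L (ρ h v)) := by
  simp [average]

theorem average_equivariant (L : V →ₗ[k] W) (a : G) (v : V) :
    average ρ σ L (ρ a v) = σ a (average ρ σ L v) := by
  rw [average_apply, average_apply, map_smul, map_sum]
  congr 1
  refine Fintype.sum_equiv (Equiv.mulRight a) _ _ fun h => ?_
  rw [← Module.End.mul_apply, ← map_mul, ← Module.End.mul_apply (σ a), ← map_mul]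
  simp

variable [CharZero k]

/-- Every summand `σ a⁻¹ (L (ρ a v))` already equals `w`. The condition concerns a single orbit, so
it applies to an `L` that is equivariant only on part of `V`. -/
theorem average_apply_eq {L : V →ₗ[k] W} {v : V} {w : W}
    (h : ∀ a, L (ρ a v) = σ a w) : average ρ σ L v = w := by
  have : (Fintype.card G : k) ≠ 0 := Nat.cast_ne_zero.2 Fintype.card_ne_zero
  simp [average_apply, h, ← Nat.cast_smul_eq_nsmul k, smul_smul, this]

/-- Averaging a linear lift of an equivariant map `q` through an equivariant `p` gives another lift.
-/
theorem comp_average_eq {τ : Representation k G X} {L : V →ₗ[k] W} {p : W →ₗ[k] X}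
    {q : V →ₗ[k] X} (hp : ∀ a w, p (σ a w) = τ a (p w)) (hq : ∀ a v, q (ρ a v) = τ a (q v))
    (h : ∀ v, p (L v) = q v) (v : V) : p (average ρ σ L v) = q v := by
  have : (Fintype.card G : k) ≠ 0 := Nat.cast_ne_zero.2 Fintype.card_ne_zero
  simp [average_apply, h, hp, hq, ← Nat.cast_smul_eq_nsmul k, smul_smul, this]

end average

/-- Transport of a representation along a linear equivalence. -/
def transport (ρ : Representation k G V) (e : V ≃ₗ[k] W) : Representation k G W where
  toFun h := e.toLinearMap ∘ₗ ρ h ∘ₗ e.symm.toLinearMap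
  map_one' := by ext; simp
  map_mul' a b := by ext; simp

theorem nonempty_equiv_of {ρ : Representation k G V} {σ : Representation k G W} (e : V ≃ₗ[k] W)
    (he : ∀ h v, e (ρ h v) = σ h (e v)) : Nonempty (ρ.Equiv σ) :=
  ⟨.mk e fun h => LinearMap.ext fun v => he h v⟩

theorem Equiv.map_apply {ρ : Representation k G V} {σ : Representation k G W} (e : ρ.Equiv σ)
    (h : G) (v : V) : e.toLinearEquiv (ρ h v) = σ h (e.toLinearEquiv v) :=
  IntertwiningMap.isIntertwining _ _ e.toIntertwiningMap h v

/-- Scalars do not affect which subspaces are stable; allowing `c` covers isomorphisms and twists by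
characters at once. -/
theorem IsIrreducible.of_equivariant {ρ : Representation k G V} {σ : Representation k G W}
    (hρ : ρ.IsIrreducible) (e : V ≃ₗ[k] W) (c : G → k)
    (he : ∀ h v, e (ρ h v) = c h • σ h (e v)) : σ.IsIrreducible := by
  obtain ⟨_, H⟩ := (isIrreducible_iff_invariant ρ).1 hρ
  refine (isIrreducible_iff_invariant σ).2 ⟨e.symm.toEquiv.nontrivial, fun p hp => ?_⟩
  have hcomap := H (p.comap e.toLinearMap) fun h v hv => by
    simpa [he] using p.smul_mem (c h) (hp h _ hv)
  have hmap : (p.comap e.toLinearMap).map e.toLinearMap = p :=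
    Submodule.map_comap_eq_of_surjective e.surjective p
  refine hcomap.imp (fun h => ?_) (fun h => ?_)
  · rw [← hmap, h, Submodule.map_bot]
  · rw [← hmap, h, Submodule.map_top, LinearMap.range_eq_top.2 e.surjective]

/-- By Maschke, `K` has a nonzero stable complement, and semisimplicity supplies an atom below it.
The space `X` may be infinite-dimensional. -/
theorem exists_isIrreducible_subrepresentation [Finite G] [CharZero k] (σ : Representation k G X)
    {K : Submodule k X} (hK : ∀ h, ∀ x ∈ K, σ h x ∈ K) (hne : K ≠ ⊤) :
    ∃ s : Subrepresentation σ, s.toRepresentation.IsIrreducible ∧ Disjoint s.toSubmodule K := by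
  have : NeZero (Nat.card G : k) := ⟨Nat.cast_ne_zero.2 Nat.card_pos.ne'⟩
  let φ := Subrepresentation.subrepresentationSubmoduleOrderIso (ρ := σ)
  obtain ⟨C, hC⟩ := exists_isCompl (φ ⟨K, fun h x hx => hK h x hx⟩)
  have hCne : C ≠ ⊥ := by
    rintro rfl
    have h1 := eq_top_of_isCompl_bot hC
    rw [map_eq_top_iff] at h1
    exact hne (congrArg Subrepresentation.toSubmodule h1)
  obtain ⟨a, ha, haC⟩ := (IsAtomic.eq_bot_or_exists_atom_le C).resolve_left hCne
  obtain ⟨s, rfl⟩ := φ.surjective a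
  rw [OrderIso.isAtom_iff] at ha
  refine ⟨s, (isIrreducible_iff_invariant _).2 ⟨?_, fun p hp => ?_⟩, ?_⟩
  · rw [Submodule.nontrivial_iff_ne_bot]
    exact fun h => ha.1 (Subrepresentation.toSubmodule_injective h)
  · let t : Subrepresentation σ := ⟨p.map s.toSubmodule.subtype, by
      rintro h _ ⟨v, hv, rfl⟩
      exact ⟨_, hp h v hv, rfl⟩⟩
    have hts : t ≤ s := by
      rintro _ ⟨v, hv, rfl⟩
      exact v.2
    rcases ha.le_iff.1 hts with h | h
    · left
      refine (Submodule.eq_bot_iff _).2 fun v hv => ?_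
      have : (v : X) ∈ t.toSubmodule := ⟨v, hv, rfl⟩
      rw [h] at this
      exact Subtype.ext this
    · right
      refine Submodule.eq_top_iff'.2 fun v => ?_
      have : (v : X) ∈ t.toSubmodule := by rw [h]; exact v.2
      obtain ⟨w, hw, hwv⟩ := this
      rwa [← Subtype.ext hwv]
  · rw [Submodule.disjoint_def]
    intro x hx hxK
    have h1 := (hC.disjoint.symm.mono_left haC)
    rw [Submodule.disjoint_def] at h1
    exact h1 x hx hxK

end

section

variable {k : Type u} {G : Type v} [Field k] [Group G] {ι : Type*} {V : ι → Type w}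
  [∀ i, AddCommGroup (V i)] [∀ i, Module k (V i)] {ρ : ∀ i, Representation k G (V i)}

/-- Completeness is assumed only in the universe of `k`. An irreducible space is finite-dimensional,
so coordinates move it there from any universe. -/
theorem IsIrreducible.exists_equiv [Finite G]
    (hcomplete : ∀ (W : Type u) [AddCommGroup W] [Module k W] (σ : Representation k G W),
      σ.IsIrreducible → ∃ i, Nonempty (σ.Equiv (ρ i)))
    {X : Type*} [AddCommGroup X] [Module k X] {σ : Representation k G X} (hσ : σ.IsIrreducible) :
    ∃ i, ∃ e : X ≃ₗ[k] V i, ∀ h x, e (σ h x) = ρ i h (e x) := by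
  have := hσ.finiteDimensional
  let b := (Module.finBasis k X).equivFun
  obtain ⟨i, ⟨e⟩⟩ := hcomplete _ (σ.transport b)
    (hσ.of_equivariant b 1 fun h v => by simp [transport])
  refine ⟨i, b.trans e.toLinearEquiv, fun h v => ?_⟩
  rw [LinearEquiv.trans_apply, LinearEquiv.trans_apply, ← e.map_apply]
  simp [transport]

theorem exists_equivariant_notMem [Finite G] [CharZero k]
    (hcomplete : ∀ (W : Type u) [AddCommGroup W] [Module k W] (σ : Representation k G W),
      σ.IsIrreducible → ∃ i, Nonempty (σ.Equiv (ρ i)))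
    {X : Type*} [AddCommGroup X] [Module k X] (σ : Representation k G X)
    {K : Submodule k X} (hK : ∀ h, ∀ x ∈ K, σ h x ∈ K) (hne : K ≠ ⊤) :
    ∃ i, ∃ f : V i →ₗ[k] X, (∀ h v, f (ρ i h v) = σ h (f v)) ∧ ∀ v, f v ∈ K → v = 0 := by
  obtain ⟨s, hs, hsK⟩ := exists_isIrreducible_subrepresentation σ hK hne
  obtain ⟨i, e, he⟩ := hs.exists_equiv hcomplete
  refine ⟨i, s.toSubmodule.subtype ∘ₗ e.symm.toLinearMap, fun h v => ?_,
    fun v hv => ?_⟩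
  · obtain ⟨w, rfl⟩ := e.surjective v
    rw [← he]
    simp [Subrepresentation.toRepresentation]
  · have h1 := Submodule.disjoint_def.1 hsK _ (e.symm v).2 hv
    simpa using h1

end

end Representation

namespace GroupDatum

variable {k : Type u} {G : Type v} [Field k] [Group G] (D : GroupDatum k G)

/-! ### The algebra `H_D` -/

theorem ofG_one : D.ofG 1 = 1 := by
  simpa [ofG] using RingQuot.mkAlgHom_rel k (Rel.one (D := D))

theorem ofG_mul (a b : G) : D.ofG (a * b) = D.ofG a * D.ofG b := by
  simpa [ofG] using RingQuot.mkAlgHom_rel k (Rel.mul (D := D) a b)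

theorem y_mul_ofG (h : G) : D.y * D.ofG h = (D.χ h : k) • (D.ofG h * D.y) := by
  simpa [ofG, y] using RingQuot.mkAlgHom_rel k (Rel.comm (D := D) h)

/-- The inclusion of the group into `H_D`. -/
noncomputable def ofGHom : G →* D.H where
  toFun := D.ofG
  map_one' := D.ofG_one
  map_mul' := D.ofG_mul

variable {D} in
-- The relation `μ (g ^ n - 1) = 0` holds in `kG` and is pushed forward to `H_D`.
theorem IsNilpotentType.y_pow (hD : D.IsNilpotentType) : D.y ^ D.n = 0 := by
  have h1 : D.y ^ D.n = D.μ • (D.ofG D.g ^ D.n - 1) := by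
    simpa [ofG, y] using RingQuot.mkAlgHom_rel k (Rel.pow (D := D))
  have h2 := congrArg (MonoidAlgebra.lift k D.H G D.ofGHom) hD
  rw [map_smul, map_sub, map_pow, map_one, map_zero, MonoidAlgebra.lift_of] at h2
  exact h1.trans h2

theorem y_pow_mul_ofG (t : ℕ) (h : G) :
    D.y ^ t * D.ofG h = (D.χ h : k) ^ t • (D.ofG h * D.y ^ t) := by
  induction t with
  | zero => simp
  | succ t ih =>
    rw [pow_succ', mul_assoc, ih, mul_smul_comm, ← mul_assoc, y_mul_ofG, smul_mul_assoc,
      smul_smul, mul_assoc, pow_succ]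

theorem adjoin_eq_top : Algebra.adjoin k (insert D.y (Set.range D.ofG)) = ⊤ := by
  have h1 : (RingQuot.mkAlgHom k D.Rel).range = ⊤ :=
    (AlgHom.range_eq_top _).2 (RingQuot.mkAlgHom_surjective k D.Rel)
  rw [← h1, ← Algebra.map_top, ← FreeAlgebra.adjoin_range_ι, AlgHom.map_adjoin]
  congr 1
  ext a
  constructor
  · rintro (rfl | ⟨h, rfl⟩)
    · exact ⟨_, ⟨none, rfl⟩, rfl⟩
    · exact ⟨_, ⟨some h, rfl⟩, rfl⟩
  · rintro ⟨_, ⟨_ | h, rfl⟩, rfl⟩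
    · exact Or.inl rfl
    · exact Or.inr ⟨h, rfl⟩

@[elab_as_elim]
theorem H_induction {P : D.H → Prop} (scalar : ∀ c : k, P (algebraMap k D.H c))
    (ofG : ∀ h, P (D.ofG h)) (y : P D.y) (add : ∀ a b, P a → P b → P (a + b))
    (mul : ∀ a b, P a → P b → P (a * b)) (a : D.H) : P a := by
  have ha : a ∈ Algebra.adjoin k (insert D.y (Set.range D.ofG)) := by
    rw [adjoin_eq_top]; trivial
  induction ha using Algebra.adjoin_induction with
  | mem x hx =>
    rcases hx with rfl | ⟨h, rfl⟩
    · exact y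
    · exact ofG h
  | algebraMap r => exact scalar r
  | add x y _ _ hx hy => exact add x y hx hy
  | mul x y _ _ hx hy => exact mul x y hx hy

section Modules

variable {X Z : Type*} [AddCommGroup X] [Module k X] [Module D.H X] [IsScalarTower k D.H X]
  [AddCommGroup Z] [Module k Z] [Module D.H Z] [IsScalarTower k D.H Z]

/-- A subspace stable under the generators of `H_D` is a submodule. -/
def stableSubmodule (N : Submodule k X) (hG : ∀ h, ∀ x ∈ N, D.ofG h • x ∈ N)
    (hy : ∀ x ∈ N, D.y • x ∈ N) : Submodule D.H X where
  toAddSubmonoid := N.toAddSubmonoid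
  smul_mem' a := by
    induction a using D.H_induction with
    | scalar c => intro x hx; rw [algebraMap_smul]; exact N.smul_mem c hx
    | ofG h => exact fun {x} hx => hG h x hx
    | y => exact fun {x} hx => hy x hx
    | add a b ha hb => intro x hx; rw [add_smul]; exact N.add_mem (ha hx) (hb hx)
    | mul a b ha hb => intro x hx; rw [mul_smul]; exact ha (hb hx)

/-- A linear map commuting with the generators of `H_D` is a homomorphism of `H_D`-modules. -/
def linearMapOf (f : X →ₗ[k] Z) (hG : ∀ h x, f (D.ofG h • x) = D.ofG h • f x)
    (hy : ∀ x, f (D.y • x) = D.y • f x) : X →ₗ[D.H] Z where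
  toFun := f
  map_add' := f.map_add
  map_smul' a := by
    induction a using D.H_induction with
    | scalar c => intro x; simp [algebraMap_smul]
    | ofG h => exact hG h
    | y => exact hy
    | add a b ha hb => intro x; simp only [add_smul, map_add, ha, hb, RingHom.id_apply]
    | mul a b ha hb =>
      intro x
      simp only [RingHom.id_apply] at ha hb ⊢
      simp only [mul_smul, ha, hb]

@[simp]
theorem linearMapOf_apply (f : X →ₗ[k] Z) (hG : ∀ h x, f (D.ofG h • x) = D.ofG h • f x)
    (hy : ∀ x, f (D.y • x) = D.y • f x) (x : X) : D.linearMapOf f hG hy x = f x := rfl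

variable (X) in
/-- The representation of `G` on an `H_D`-module. -/
noncomputable def restrictRep : Representation k G X where
  toFun h := Algebra.lsmul k k X (D.ofG h)
  map_one' := by rw [ofG_one, map_one]
  map_mul' a b := by rw [ofG_mul, map_mul]

@[simp]
theorem restrictRep_apply (h : G) (x : X) : D.restrictRep X h x = D.ofG h • x := rfl

theorem y_pow_smul_ofG_smul (t : ℕ) (h : G) (x : X) :
    D.y ^ t • D.ofG h • x = (D.χ h : k) ^ t • D.ofG h • D.y ^ t • x := by
  rw [← mul_smul, y_pow_mul_ofG, smul_assoc, mul_smul]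

end Modules

/-- The elements `h y^t` with `t < n` span a left ideal containing `1`. -/
theorem finiteDimensional_H [Finite G] (hD : D.IsNilpotentType) : FiniteDimensional k D.H := by
  let S : Set D.H := Set.range fun p : G × Fin D.n => D.ofG p.1 * D.y ^ (p.2 : ℕ)
  have hmem (h : G) (t : ℕ) : D.ofG h * D.y ^ t ∈ Submodule.span k S := by
    by_cases ht : t < D.n
    · exact Submodule.subset_span ⟨(h, ⟨t, ht⟩), rfl⟩
    · rw [pow_eq_zero_of_le (not_lt.1 ht) hD.y_pow, mul_zero]
      exact zero_mem _
  let N : Submodule D.H D.H := D.stableSubmodule (Submodule.span k S)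
    (by
      intro h x hx
      induction hx using Submodule.span_induction with
      | mem x hx =>
        obtain ⟨⟨a, t⟩, rfl⟩ := hx
        simpa [← mul_assoc, ← ofG_mul] using hmem (h * a) t
      | zero => simp
      | add x y _ _ hx hy => rw [smul_add]; exact add_mem hx hy
      | smul c x _ hx => rw [smul_comm]; exact Submodule.smul_mem _ c hx)
    (by
      intro x hx
      induction hx using Submodule.span_induction with
      | mem x hx =>
        obtain ⟨⟨a, t⟩, rfl⟩ := hx
        have := Submodule.smul_mem _ (D.χ a : k) (hmem a (t + 1))
        simpa [← mul_assoc, y_mul_ofG, pow_succ'] using this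
      | zero => simp
      | add x y _ _ hx hy => rw [smul_add]; exact add_mem hx hy
      | smul c x _ hx => rw [smul_comm]; exact Submodule.smul_mem _ c hx)
  have hN : N = ⊤ := by
    refine (Ideal.eq_top_iff_one N).2 ?_
    have := hmem 1 0
    rwa [pow_zero, mul_one, ofG_one] at this
  refine ⟨?_⟩
  have htop : Submodule.span k S = ⊤ :=
    Submodule.eq_top_iff'.2 fun x => (by rw [hN]; trivial : x ∈ N)
  rw [← htop]
  exact Submodule.fg_span (Set.finite_range _)

/-- For a simple quotient `S` of `H_D`, the subspace `yS` is a submodule. It is not `S`, because `y`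
is nilpotent, so `yS = 0`. -/
theorem y_mem_jacobson (hD : D.IsNilpotentType) : D.y ∈ Ring.jacobson D.H := by
  refine Submodule.mem_sInf.2 fun I hI => ?_
  have hnil (x : D.H ⧸ I) : D.y ^ D.n • x = 0 := by rw [hD.y_pow, zero_smul]
  let f := Algebra.lsmul k k (D.H ⧸ I) D.y
  let N : Submodule D.H (D.H ⧸ I) := D.stableSubmodule (LinearMap.range f)
    (by
      rintro h _ ⟨x, rfl⟩
      refine ⟨(D.χ h : k)⁻¹ • D.ofG h • x, ?_⟩
      have := D.y_pow_smul_ofG_smul 1 h x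
      rw [pow_one, pow_one] at this
      rw [map_smul]
      change _ • D.y • D.ofG h • x = _
      rw [this, smul_smul, inv_mul_cancel₀ (Units.ne_zero _), one_smul]
      rfl)
    (by
      rintro _ ⟨x, rfl⟩
      exact ⟨D.y • x, rfl⟩)
  have hsimple : IsSimpleModule D.H (D.H ⧸ I) := isSimpleModule_iff_isCoatom.2 hI
  rcases eq_bot_or_eq_top N with h | h
  · have : D.y • (Submodule.Quotient.mk 1 : D.H ⧸ I) ∈ N := ⟨_, rfl⟩
    rw [h, Submodule.mem_bot, ← Submodule.Quotient.mk_smul, smul_eq_mul, mul_one,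
      Submodule.Quotient.mk_eq_zero] at this
    exact this
  · exfalso
    have hsurj : Function.Surjective f := fun x => (by rw [h]; trivial : x ∈ N)
    have hpow : Function.Surjective (f ^ D.n) := by
      rw [Module.End.coe_pow]
      exact hsurj.iterate _
    have hz : f ^ D.n = 0 := by
      rw [← map_pow, hD.y_pow, map_zero]
    have := IsSimpleModule.nontrivial D.H (D.H ⧸ I)
    obtain ⟨x, hx⟩ := exists_ne (0 : D.H ⧸ I)
    obtain ⟨z, rfl⟩ := hpow x
    exact hx (by rw [hz]; rfl)

end GroupDatum

/-! ### Coordinates and submodules of `M(V, j)` -/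

namespace GroupDatum

variable {k : Type u} {G : Type v} [Field k] [Group G] (D : GroupDatum k G)

section Infl

variable (hD : D.IsNilpotentType) (hn : 2 ≤ D.n)
  {V : Type*} [AddCommGroup V] [Module k V] (ρ : Representation k G V)

/-- The linear identification of an inflated module with the underlying space. -/
def inflEquiv : D.Infl hD hn ρ ≃ₗ[k] V := LinearEquiv.refl k V

theorem inflEquiv_ofG_smul (h : G) (x : D.Infl hD hn ρ) :
    D.inflEquiv hD hn ρ (D.ofG h • x) = ρ h (D.inflEquiv hD hn ρ x) :=
  LinearMap.congr_fun (D.action_ofG hD ρ 0 (zero_pow (by omega)) (fun h => by simp) h) x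

theorem inflEquiv_y_smul (x : D.Infl hD hn ρ) : D.inflEquiv hD hn ρ (D.y • x) = 0 :=
  LinearMap.congr_fun (D.action_y hD ρ 0 (zero_pow (by omega)) (fun h => by simp)) x

end Infl

section M

variable (hD : D.IsNilpotentType) {V : Type*} [AddCommGroup V] [Module k V]
  (ρ : Representation k G V) {j : ℕ} (hj : j ≤ D.n)

/-- The coordinates on `M(V, j)`. -/
def coords : D.M hD ρ j hj ≃ₗ[k] (Fin j → V) := LinearEquiv.refl k (Fin j → V)

variable {D hD ρ hj} in
theorem M_ext {f f' : D.M hD ρ j hj}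
    (h : ∀ l, D.coords hD ρ hj f l = D.coords hD ρ hj f' l) : f = f' :=
  (D.coords hD ρ hj).injective (funext h)

theorem coords_ofG_smul (h : G) (f : D.M hD ρ j hj) (l : Fin j) :
    D.coords hD ρ hj (D.ofG h • f) l =
      ((D.χ h : k)⁻¹ ^ (l : ℕ)) • ρ h (D.coords hD ρ hj f l) := by
  have := LinearMap.congr_fun (D.action_ofG hD (D.stringRep ρ j) (stringShift k V j)
    (stringShift_pow_eq_zero V hj) (D.stringShift_comm ρ j) h) (D.coords hD ρ hj f)
  refine (congrFun this l).trans ?_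
  simp [stringRep]

theorem coords_y_smul (f : D.M hD ρ j hj) (l : Fin j) :
    D.coords hD ρ hj (D.y • f) l =
      if h : (l : ℕ) = 0 then 0 else D.coords hD ρ hj f ⟨(l : ℕ) - 1, by omega⟩ :=
  congrFun (LinearMap.congr_fun (D.action_y hD (D.stringRep ρ j) (stringShift k V j)
    (stringShift_pow_eq_zero V hj) (D.stringShift_comm ρ j)) (D.coords hD ρ hj f)) l

theorem coords_y_pow_smul (t : ℕ) (f : D.M hD ρ j hj) (l : Fin j) :
    D.coords hD ρ hj (D.y ^ t • f) l =
      if h : (l : ℕ) < t then 0 else D.coords hD ρ hj f ⟨(l : ℕ) - t, by omega⟩ := by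
  induction t generalizing l with
  | zero => simp
  | succ t ih =>
    rw [pow_succ', mul_smul, coords_y_smul]
    by_cases h : (l : ℕ) = 0
    · simp [h]
    · rw [dif_neg h, ih]
      by_cases h' : (l : ℕ) < t + 1
      · rw [dif_pos h', dif_pos (by simp only; omega)]
      · rw [dif_neg h', dif_neg (by simp only; omega)]
        exact congrArg _ (Fin.ext (Nat.sub_sub _ _ _ |>.trans (by rw [add_comm])))

/-- The submodule `x^a V ⊕ ⋯ ⊕ x^{j-1} V` of `M(V, j)`. -/
noncomputable def filtration (a : ℕ) : Submodule D.H (D.M hD ρ j hj) :=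
  D.stableSubmodule
    { carrier := {f | ∀ l : Fin j, (l : ℕ) < a → D.coords hD ρ hj f l = 0}
      zero_mem' := fun _ _ => by simp
      add_mem' := fun {f f'} hf hf' l hl => by simp [hf l hl, hf' l hl]
      smul_mem' := fun c f hf l hl => by simp [hf l hl] }
    (fun h f hf l hl => by rw [coords_ofG_smul, hf l hl]; simp)
    (fun f hf l hl => by
      rw [coords_y_smul]
      split_ifs
      · rfl
      · exact hf _ (by simp only; omega))

variable {D hD ρ hj}

theorem filtration_antitone : Antitone (D.filtration hD ρ hj) :=
  fun _ _ hab _ hf l hl => hf l (hl.trans_le hab)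

theorem filtration_zero : D.filtration hD ρ hj 0 = ⊤ :=
  Submodule.eq_top_iff'.2 fun _ _ hl => absurd hl (Nat.not_lt_zero _)

theorem filtration_self : D.filtration hD ρ hj j = ⊥ :=
  (Submodule.eq_bot_iff _).2 fun f hf => M_ext fun l => by simp [hf l l.2]

variable (D hD hj ρ) in
/-- The element `x^a v` of `M(V, j)`. -/
noncomputable def monomial (a : Fin j) (v : V) : D.M hD ρ j hj :=
  (D.coords hD ρ hj).symm (Pi.single a v)

theorem coords_monomial (a : Fin j) (v : V) :
    D.coords hD ρ hj (D.monomial hD ρ hj a v) = Pi.single a v :=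
  LinearEquiv.apply_symm_apply _ _

theorem filtration_ne_of_lt [Nontrivial V] {a b : ℕ} (hab : a < b) (ha : a < j) :
    D.filtration hD ρ hj a ≠ D.filtration hD ρ hj b := by
  obtain ⟨v, hv⟩ := exists_ne (0 : V)
  intro h
  have h1 : D.monomial hD ρ hj ⟨a, ha⟩ v ∈ D.filtration hD ρ hj a := fun l hl => by
    rw [coords_monomial, Pi.single_eq_of_ne]
    rintro rfl
    exact lt_irrefl _ hl
  rw [h] at h1
  have h2 := h1 ⟨a, ha⟩ hab
  rw [coords_monomial, Pi.single_eq_same] at h2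
  exact hv h2

/-- The submodule generated by an element with nonzero leading coefficient. -/
theorem filtration_le_of_mem (hρ : ρ.IsIrreducible) {N : Submodule D.H (D.M hD ρ j hj)}
    {a : ℕ} (ha : a < j) {f : D.M hD ρ j hj} (hfN : f ∈ N) (hf : f ∈ D.filtration hD ρ hj a)
    (hfa : D.coords hD ρ hj f ⟨a, ha⟩ ≠ 0) : D.filtration hD ρ hj a ≤ N := by
  obtain ⟨-, H⟩ := (Representation.isIrreducible_iff_invariant ρ).1 hρ
  let N' : Submodule k (D.M hD ρ j hj) :=
    N.restrictScalars k ⊓ (D.filtration hD ρ hj a).restrictScalars k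
  -- The degree `a` coefficients of the elements of `N ∩ F_a`. The factor `χ(h)^a` below undoes the
  -- twist in that degree, so `p` is `G`-stable.
  let p : Submodule k V := N'.map (LinearMap.proj ⟨a, ha⟩ ∘ₗ (D.coords hD ρ hj).toLinearMap)
  have hp : p = ⊤ := by
    refine (H p ?_).resolve_left fun h => hfa ?_
    · rintro h _ ⟨f', ⟨hf'N, hf'⟩, rfl⟩
      refine ⟨(D.χ h : k) ^ a • D.ofG h • f', N'.smul_mem _ ⟨N.smul_mem _ hf'N,
        (D.filtration hD ρ hj a).smul_mem _ hf'⟩, ?_⟩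
      simp only [LinearMap.comp_apply, LinearMap.proj_apply, LinearEquiv.coe_coe, map_smul]
      rw [coords_ofG_smul, smul_smul, ← mul_pow, mul_inv_cancel₀ (Units.ne_zero _), one_pow,
        one_smul]
    · have : D.coords hD ρ hj f ⟨a, ha⟩ ∈ p := ⟨f, ⟨hfN, hf⟩, rfl⟩
      rwa [h] at this
  -- Descending induction on `b`: some `z ∈ N ∩ F_a` has as leading coefficient that of `f'`, and
  -- `f' - y^(b-a) z` lies in `F_{b+1}`, already known to be inside `N`.
  have hstep (d b : ℕ) (hb : b + d = j) (hab : a ≤ b) : D.filtration hD ρ hj b ≤ N := by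
    induction d generalizing b with
    | zero =>
      obtain rfl : b = j := hb
      rw [filtration_self]
      exact bot_le
    | succ d ih =>
      intro f' hf'
      have hbj : b < j := by omega
      have hv : D.coords hD ρ hj f' ⟨b, hbj⟩ ∈ p := by rw [hp]; trivial
      obtain ⟨z, ⟨hzN, hz⟩, hzv⟩ := hv
      have hyz : D.y ^ (b - a) • z ∈ N := N.smul_mem _ hzN
      refine (Submodule.sub_mem_iff_left N hyz).1 (ih (b + 1) (by omega) (by omega) ?_)
      intro l hl
      rw [map_sub, Pi.sub_apply, coords_y_pow_smul]
      rcases Nat.lt_succ_iff_lt_or_eq.1 hl with hl | hl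
      · rw [hf' l hl, zero_sub, neg_eq_zero]
        split_ifs with h
        · rfl
        · exact hz _ (by simp only; omega)
      · obtain rfl : l = ⟨b, hbj⟩ := Fin.ext hl
        rw [dif_neg (by simp only; omega), sub_eq_zero, ← hzv]
        simp only [LinearMap.comp_apply, LinearMap.proj_apply, LinearEquiv.coe_coe]
        exact congrArg _ (Fin.ext (Nat.sub_sub_self hab).symm)
  exact hstep (j - a) a (by omega) le_rfl

/-- Take the largest `a ≤ j` with `N ≤ F_a`. If `a < j`, some element of `N` has a nonzero
coefficient in degree exactly `a`, and it forces `F_a ≤ N`. -/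
theorem exists_eq_filtration (hρ : ρ.IsIrreducible) (N : Submodule D.H (D.M hD ρ j hj)) :
    ∃ a ≤ j, N = D.filtration hD ρ hj a := by
  classical
  have h0 : ∃ a, a ≤ j ∧ N ≤ D.filtration hD ρ hj a :=
    ⟨0, Nat.zero_le _, by rw [filtration_zero]; exact le_top⟩
  set a := Nat.findGreatest (fun a => N ≤ D.filtration hD ρ hj a) j with ha_def
  have haN : N ≤ D.filtration hD ρ hj a :=
    Nat.findGreatest_spec (P := fun a => N ≤ D.filtration hD ρ hj a) (Nat.zero_le j)
      (by rw [filtration_zero]; exact le_top)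
  have haj : a ≤ j := Nat.findGreatest_le j
  refine ⟨a, haj, le_antisymm haN ?_⟩
  rcases haj.eq_or_lt with h | h
  · rw [h, filtration_self]
    exact bot_le
  · have hnot : ¬ N ≤ D.filtration hD ρ hj (a + 1) :=
      Nat.findGreatest_is_greatest (P := fun a => N ≤ D.filtration hD ρ hj a)
        (Nat.lt_succ_self a) h
    obtain ⟨f, hfN, hf⟩ := SetLike.not_le_iff_exists.1 hnot
    refine filtration_le_of_mem hρ h hfN (haN hfN) fun h0 => hf fun l hl => ?_
    rcases Nat.lt_succ_iff_lt_or_eq.1 hl with hl | hl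
    · exact haN hfN l hl
    · obtain rfl : l = ⟨a, h⟩ := Fin.ext hl
      exact h0

theorem M_isUniserial (hρ : ρ.IsIrreducible) : IsUniserialModule D.H (D.M hD ρ j hj) := by
  intro N N'
  obtain ⟨a, -, rfl⟩ := exists_eq_filtration hρ N
  obtain ⟨b, -, rfl⟩ := exists_eq_filtration hρ N'
  exact (le_total b a).imp (fun h => filtration_antitone h) (fun h => filtration_antitone h)

theorem _root_.IsUniserialModule.isIndecomposable {R X : Type*} [Ring R] [AddCommGroup X]
    [Module R X] [Nontrivial X] (h : IsUniserialModule R X) : IsIndecomposableModule R X := by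
  refine ⟨inferInstance, fun N N' hN => (h N N').imp (fun h => ?_) (fun h => ?_)⟩
  · exact le_bot_iff.1 (hN.disjoint le_rfl h)
  · exact le_bot_iff.1 (hN.disjoint h le_rfl)

theorem M_nontrivial [Nontrivial V] (h1 : 1 ≤ j) : Nontrivial (D.M hD ρ j hj) :=
  have : Nonempty (Fin j) := ⟨⟨0, h1⟩⟩
  (D.coords hD ρ hj).toEquiv.nontrivial

theorem M_isIndecomposable (hρ : ρ.IsIrreducible) (h1 : 1 ≤ j) :
    IsIndecomposableModule D.H (D.M hD ρ j hj) :=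
  have := ((Representation.isIrreducible_iff_invariant ρ).1 hρ).1
  have := M_nontrivial (D := D) (hD := hD) (ρ := ρ) (hj := hj) h1
  (M_isUniserial hρ).isIndecomposable

/-! ### Radical and socle -/

theorem filtration_one_isCoatom (hρ : ρ.IsIrreducible) (h1 : 1 ≤ j) :
    IsCoatom (D.filtration hD ρ hj 1) := by
  have := ((Representation.isIrreducible_iff_invariant ρ).1 hρ).1
  refine ⟨?_, fun N hN => ?_⟩
  · rw [← filtration_zero]
    exact (filtration_ne_of_lt zero_lt_one h1).symm
  · obtain ⟨a, -, rfl⟩ := exists_eq_filtration hρ N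
    obtain rfl : a = 0 := by
      by_contra h
      exact hN.not_ge (filtration_antitone (Nat.one_le_iff_ne_zero.2 h))
    exact filtration_zero

theorem filtration_one_le_radical :
    D.filtration hD ρ hj 1 ≤ radicalSubmodule D.H (D.M hD ρ j hj) := by
  intro f hf
  -- Shift `f` down one degree; the top coordinate is irrelevant because `y` kills it.
  let f' : D.M hD ρ j hj := (D.coords hD ρ hj).symm fun l =>
    if h : (l : ℕ) + 1 < j then D.coords hD ρ hj f ⟨l + 1, h⟩ else 0
  have : f = D.y • f' := M_ext fun l => by
    rw [coords_y_smul, LinearEquiv.apply_symm_apply]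
    split_ifs with h h'
    · exact hf l (by omega)
    · exact congrArg _ (Fin.ext (by dsimp only; omega))
    · exact absurd l.2 (by dsimp only at h'; omega)
  rw [this]
  exact Submodule.smul_mem_smul (D.y_mem_jacobson hD) trivial

theorem jacobson_le_filtration_one (hρ : ρ.IsIrreducible) (h1 : 1 ≤ j) :
    Module.jacobson D.H (D.M hD ρ j hj) ≤ D.filtration hD ρ hj 1 :=
  sInf_le (filtration_one_isCoatom hρ h1)

/-- The chain `F_1 ≤ J M ≤ rad M ≤ F_1` closes up: `F_1 = yM` with `y ∈ J`, and `F_1` is maximal. -/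
theorem radical_eq_filtration_one (hρ : ρ.IsIrreducible) (h1 : 1 ≤ j) :
    radicalSubmodule D.H (D.M hD ρ j hj) = D.filtration hD ρ hj 1 :=
  le_antisymm ((Ring.jacobson_smul_top_le _ _).trans (jacobson_le_filtration_one hρ h1))
    filtration_one_le_radical

theorem jacobson_eq_filtration_one (hρ : ρ.IsIrreducible) (h1 : 1 ≤ j) :
    Module.jacobson D.H (D.M hD ρ j hj) = D.filtration hD ρ hj 1 :=
  le_antisymm (jacobson_le_filtration_one hρ h1)
    (filtration_one_le_radical.trans (Ring.jacobson_smul_top_le _ _))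

/-- The submodules form a chain, so the smallest nonzero one is the only simple submodule. -/
theorem socle_eq_filtration (hρ : ρ.IsIrreducible) (h1 : 1 ≤ j) :
    socleSubmodule D.H (D.M hD ρ j hj) = D.filtration hD ρ hj (j - 1) := by
  have := ((Representation.isIrreducible_iff_invariant ρ).1 hρ).1
  have hne : D.filtration hD ρ hj (j - 1) ≠ ⊥ := by
    rw [← filtration_self]
    exact filtration_ne_of_lt (by omega) (by omega)
  have hatom : IsAtom (D.filtration hD ρ hj (j - 1)) := by
    refine ⟨hne, fun N hN => ?_⟩
    obtain ⟨a, haj, rfl⟩ := exists_eq_filtration hρ N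
    obtain rfl : a = j := by
      by_contra h
      exact hN.not_ge (filtration_antitone (by omega))
    exact filtration_self
  refine le_antisymm (sSup_le fun N hN => ?_) (le_sSup (isSimpleModule_iff_isAtom.2 hatom))
  have hN' : IsAtom N := isSimpleModule_iff_isAtom.1 hN
  obtain ⟨a, haj, rfl⟩ := exists_eq_filtration hρ N
  have ha : a < j := by
    refine lt_of_le_of_ne haj fun h => hN'.1 ?_
    rw [h, filtration_self]
  exact ((hN'.le_iff.1 (filtration_antitone (by omega))).resolve_left hne).ge

end M

end GroupDatum

/-! ### Subquotients of `M(V, j)` and isomorphism invariants -/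

namespace GroupDatum

variable {k : Type u} {G : Type v} [Field k] [Group G] {D : GroupDatum k G}

section

variable {hD : D.IsNilpotentType} {V W : Type*} [AddCommGroup V] [Module k V]
  [AddCommGroup W] [Module k W] {ρ : Representation k G V} {σ : Representation k G W}
  {j : ℕ} {hj : j ≤ D.n}

/-- The terms of the filtration of `M(V, j)` are again of the form `M(W, i)`. -/
theorem nonempty_filtration_equiv_M (a : ℕ) (e : V ≃ₗ[k] W)
    (he : ∀ h v, e (ρ h v) = (D.χ h : k) ^ a • σ h (e v)) (haj : a ≤ j) :
    Nonempty (D.filtration hD ρ hj a ≃ₗ[D.H] D.M hD σ (j - a) ((Nat.sub_le j a).trans hj)) := by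
  let f : D.filtration hD ρ hj a →ₗ[k] D.M hD σ (j - a) ((Nat.sub_le j a).trans hj) :=
    (D.coords hD σ _).symm.toLinearMap ∘ₗ
      (LinearMap.pi fun l : Fin (j - a) => e.toLinearMap ∘ₗ
        LinearMap.proj ⟨l + a, by omega⟩ ∘ₗ (D.coords hD ρ hj).toLinearMap) ∘ₗ
      ((D.filtration hD ρ hj a).restrictScalars k).subtype
  have hf (x : D.filtration hD ρ hj a) (l : Fin (j - a)) :
      D.coords hD σ _ (f x) l = e (D.coords hD ρ hj x ⟨l + a, by omega⟩) := rfl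
  let F : D.filtration hD ρ hj a →ₗ[D.H] D.M hD σ (j - a) ((Nat.sub_le j a).trans hj) :=
    D.linearMapOf (X := D.filtration hD ρ hj a) (Z := D.M hD σ (j - a) ((Nat.sub_le j a).trans hj)) f
    (fun h x => M_ext fun l => by
      rw [hf, Submodule.coe_smul, coords_ofG_smul, coords_ofG_smul, hf, map_smul, he, smul_smul,
        pow_add, mul_assoc, ← mul_pow, inv_mul_cancel₀ (Units.ne_zero _), one_pow, mul_one])
    (fun x => M_ext fun l => by
      rw [hf, Submodule.coe_smul, coords_y_smul, coords_y_smul]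
      by_cases h0 : (l : ℕ) = 0
      · rw [dif_pos h0]
        -- The lowest coordinate of `y x` comes from degree `a - 1`, where elements of the
        -- filtration term vanish.
        split_ifs with h
        · exact map_zero e
        · rw [x.2 ⟨l + a - 1, by omega⟩ (by dsimp only at h ⊢; omega), map_zero]
      · rw [dif_neg h0, dif_neg (by simp only; omega), hf]
        exact congrArg _ (congrArg _ (Fin.ext (by simp only; omega))))
  refine ⟨LinearEquiv.ofBijective F ⟨?_, fun z => ?_⟩⟩
  · intro x x' hx
    refine Subtype.ext (M_ext fun l => ?_)
    by_cases hl : (l : ℕ) < a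
    · rw [x.2 l hl, x'.2 l hl]
    · have h1 := (hf x ⟨l - a, by omega⟩).symm.trans
        ((congrArg (fun z => D.coords hD σ _ z ⟨l - a, by omega⟩) hx).trans
          (hf x' ⟨l - a, by omega⟩))
      have hla : (⟨(l : ℕ) - a + a, by omega⟩ : Fin j) = l := Fin.ext (by dsimp only; omega)
      simpa only [hla] using e.injective h1
  · refine ⟨⟨(D.coords hD ρ hj).symm fun l => if h : (l : ℕ) < a then 0 else
      e.symm (D.coords hD σ _ z ⟨l - a, by omega⟩), fun l hl => ?_⟩, M_ext fun l => ?_⟩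
    · rw [LinearEquiv.apply_symm_apply, dif_pos hl]
    · refine (hf _ l).trans ?_
      rw [LinearEquiv.apply_symm_apply, dif_neg (by simp only; omega), LinearEquiv.apply_symm_apply]
      exact congrArg _ (Fin.ext (by simp only; omega))

theorem nonempty_filtration_equiv_Infl (hn : 2 ≤ D.n) (h1 : 1 ≤ j) (e : V ≃ₗ[k] W)
    (he : ∀ h v, e (ρ h v) = (D.χ h : k) ^ (j - 1) • σ h (e v)) :
    Nonempty (D.filtration hD ρ hj (j - 1) ≃ₗ[D.H] D.Infl hD hn σ) := by
  obtain ⟨E⟩ := nonempty_filtration_equiv_M (hD := hD) (hj := hj) (j - 1) e he (Nat.sub_le j 1)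
  have h11 : j - (j - 1) = 1 := by omega
  let l0 : Fin (j - (j - 1)) := ⟨0, by omega⟩
  let f : D.M hD σ (j - (j - 1)) ((Nat.sub_le _ _).trans hj) →ₗ[k] D.Infl hD hn σ :=
    (D.inflEquiv hD hn σ).symm.toLinearMap ∘ₗ LinearMap.proj l0 ∘ₗ (D.coords hD σ _).toLinearMap
  have hf x : D.inflEquiv hD hn σ (f x) = D.coords hD σ _ x l0 := rfl
  let F := D.linearMapOf f
    (fun h x => (D.inflEquiv hD hn σ).injective (by
      rw [hf, inflEquiv_ofG_smul, hf, coords_ofG_smul, pow_zero, one_smul]))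
    (fun x => (D.inflEquiv hD hn σ).injective (by
      rw [hf, inflEquiv_y_smul, coords_y_smul, dif_pos rfl]))
  refine ⟨E.trans (LinearEquiv.ofBijective F ⟨?_, fun z => ?_⟩)⟩
  · intro x x' hxx
    refine M_ext fun l => ?_
    obtain rfl : l = l0 := Fin.ext (by simp only [l0]; omega)
    rw [← hf, ← hf]
    exact congrArg _ hxx
  · exact ⟨(D.coords hD σ _).symm fun _ => D.inflEquiv hD hn σ z, rfl⟩

variable (D ρ) in
theorem nonempty_quotient_filtration_one_equiv (hD : D.IsNilpotentType) (hj : j ≤ D.n)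
    (hn : 2 ≤ D.n) (h1 : 1 ≤ j) :
    Nonempty ((D.M hD ρ j hj ⧸ D.filtration hD ρ hj 1) ≃ₗ[D.H] D.Infl hD hn ρ) := by
  let l0 : Fin j := ⟨0, h1⟩
  let f : D.M hD ρ j hj →ₗ[k] D.Infl hD hn ρ :=
    (D.inflEquiv hD hn ρ).symm.toLinearMap ∘ₗ LinearMap.proj l0 ∘ₗ (D.coords hD ρ hj).toLinearMap
  have hf x : D.inflEquiv hD hn ρ (f x) = D.coords hD ρ hj x l0 := rfl
  let F := D.linearMapOf f
    (fun h x => (D.inflEquiv hD hn ρ).injective (by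
      rw [hf, inflEquiv_ofG_smul, hf, coords_ofG_smul, pow_zero, one_smul]))
    (fun x => (D.inflEquiv hD hn ρ).injective (by
      rw [hf, inflEquiv_y_smul, coords_y_smul, dif_pos rfl]))
  have hker : LinearMap.ker F = D.filtration hD ρ hj 1 := by
    ext x
    constructor
    · intro hx l hl
      obtain rfl : l = l0 := Fin.ext (by simp only [l0]; omega)
      exact hx
    · intro hx
      exact hx l0 zero_lt_one
  have hsurj : Function.Surjective F :=
    fun z => ⟨(D.coords hD ρ hj).symm fun _ => D.inflEquiv hD hn ρ z, rfl⟩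
  exact ⟨(Submodule.quotEquivOfEq _ _ hker.symm).trans (F.quotKerEquivOfSurjective hsurj)⟩

theorem nonempty_equiv_of_Infl_equiv {hn : 2 ≤ D.n}
    (E : D.Infl hD hn ρ ≃ₗ[D.H] D.Infl hD hn σ) : Nonempty (ρ.Equiv σ) :=
  Representation.nonempty_equiv_of
    ((D.inflEquiv hD hn ρ).symm.trans ((E.restrictScalars k).trans (D.inflEquiv hD hn σ)))
    fun h v => by
      obtain ⟨x, rfl⟩ := (D.inflEquiv hD hn ρ).surjective v
      rw [← inflEquiv_ofG_smul]
      simp only [LinearEquiv.trans_apply, LinearEquiv.symm_apply_apply,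
        LinearEquiv.restrictScalars_apply, map_smul]
      rw [inflEquiv_ofG_smul]

theorem finrank_M [FiniteDimensional k V] :
    Module.finrank k (D.M hD ρ j hj) = j * Module.finrank k V := by
  rw [(D.coords hD ρ hj).finrank_eq, Module.finrank_pi_fintype]
  simp

/-- The quotient by the radical recovers the simple representation; comparing dimensions then
recovers the length. -/
theorem eq_of_M_equiv [Finite G] (hn : 2 ≤ D.n) (hρ : ρ.IsIrreducible) (hσ : σ.IsIrreducible)
    {j' : ℕ} {hj' : j' ≤ D.n} (h1 : 1 ≤ j) (h1' : 1 ≤ j')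
    (E : D.M hD ρ j hj ≃ₗ[D.H] D.M hD σ j' hj') : Nonempty (ρ.Equiv σ) ∧ j = j' := by
  have hmap : (D.filtration hD ρ hj 1).map (E : D.M hD ρ j hj →ₗ[D.H] D.M hD σ j' hj') =
      D.filtration hD σ hj' 1 := by
    rw [← radical_eq_filtration_one hρ h1, ← radical_eq_filtration_one hσ h1', radicalSubmodule,
      radicalSubmodule, Submodule.map_smul'', Submodule.map_top, LinearEquiv.range]
  obtain ⟨e1⟩ := nonempty_quotient_filtration_one_equiv D ρ hD hj hn h1
  obtain ⟨e2⟩ := nonempty_quotient_filtration_one_equiv D σ hD hj' hn h1'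
  obtain ⟨e⟩ := nonempty_equiv_of_Infl_equiv
    (e1.symm.trans ((Submodule.Quotient.equiv _ _ E hmap).trans e2))
  refine ⟨⟨e⟩, ?_⟩
  have h := (E.restrictScalars k).finrank_eq
  have := hρ.finiteDimensional
  have := hσ.finiteDimensional
  have := ((Representation.isIrreducible_iff_invariant σ).1 hσ).1
  rw [finrank_M, finrank_M, e.toLinearEquiv.finrank_eq] at h
  exact Nat.eq_of_mul_eq_mul_right Module.finrank_pos h

end

/-! ### Homomorphisms out of and into `M(V, j)` -/

section maps

variable {hD : D.IsNilpotentType} {V : Type*} [AddCommGroup V] [Module k V]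
  {ρ : Representation k G V} {j : ℕ} {hj : j ≤ D.n}
  {X : Type*} [AddCommGroup X] [Module k X] [Module D.H X] [IsScalarTower k D.H X]

variable (hD hj) in
/-- The homomorphism `M(V, j) → X` extending an equivariant map `V → X`. -/
noncomputable def fromM (s : V →ₗ[k] X) (hs : ∀ h v, s (ρ h v) = D.ofG h • s v)
    (hy : ∀ v, D.y ^ j • s v = 0) : D.M hD ρ j hj →ₗ[D.H] X :=
  D.linearMapOf
    (∑ l : Fin j, Algebra.lsmul k k X (D.y ^ (l : ℕ)) ∘ₗ s ∘ₗ LinearMap.proj l ∘ₗ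
      (D.coords hD ρ hj).toLinearMap)
    (fun h f => by
      simp only [LinearMap.sum_apply, LinearMap.comp_apply, LinearMap.proj_apply,
        LinearEquiv.coe_coe, Algebra.lsmul_coe, Finset.smul_sum]
      refine Finset.sum_congr rfl fun l _ => ?_
      rw [coords_ofG_smul, map_smul, hs, smul_comm, y_pow_smul_ofG_smul, smul_smul, ← mul_pow,
        inv_mul_cancel₀ (Units.ne_zero _), one_pow, one_smul])
    (fun f => by
      simp only [LinearMap.sum_apply, LinearMap.comp_apply, LinearMap.proj_apply,
        LinearEquiv.coe_coe, Algebra.lsmul_coe, Finset.smul_sum]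
      cases j with
      | zero => simp
      | succ j =>
        -- The two sums agree after a shift of index, except for the degree zero term of one and the
        -- top term of the other. The first is zero by definition of the action, the second by `hy`.
        rw [Fin.sum_univ_succ, Fin.sum_univ_castSucc, coords_y_smul,
          dif_pos (show ((0 : Fin (j + 1)) : ℕ) = 0 from rfl), map_zero, smul_zero, zero_add, ← mul_smul D.y, ← pow_succ', Fin.val_last, hy, add_zero]
        refine Finset.sum_congr rfl fun l _ => ?_
        rw [coords_y_smul, dif_neg (by simp), ← mul_smul, ← pow_succ']
        rfl)

theorem fromM_apply (s : V →ₗ[k] X) (hs : ∀ h v, s (ρ h v) = D.ofG h • s v)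
    (hy : ∀ v, D.y ^ j • s v = 0) (f : D.M hD ρ j hj) :
    fromM hD hj s hs hy f = ∑ l : Fin j, D.y ^ (l : ℕ) • s (D.coords hD ρ hj f l) := by
  simp only [fromM, linearMapOf_apply, LinearMap.sum_apply]
  rfl

variable (hD hj ρ) in
/-- The homomorphism `X → M(V, j)` induced by a map `q : X → V` which is equivariant up to a
twist. -/
noncomputable def toM (q : X →ₗ[k] V)
    (hq : ∀ h x, q (D.ofG h • x) = ((D.χ h : k)⁻¹ ^ (j - 1)) • ρ h (q x))
    (hy : ∀ x : X, D.y ^ j • x = 0) : X →ₗ[D.H] D.M hD ρ j hj :=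
  D.linearMapOf
    ((D.coords hD ρ hj).symm.toLinearMap ∘ₗ
      -- Compatibility with `y` forces these coordinates once `q` is the top one; in degree zero it
      -- reads `q (y^j x) = 0`.
      LinearMap.pi fun l : Fin j => q ∘ₗ Algebra.lsmul k k X (D.y ^ (j - 1 - l)))
    (fun h x => M_ext fun l => by
      rw [coords_ofG_smul]
      simp only [LinearMap.comp_apply, LinearEquiv.coe_coe, LinearEquiv.apply_symm_apply,
        LinearMap.pi_apply, Algebra.lsmul_coe]
      rw [y_pow_smul_ofG_smul, map_smul, hq, smul_smul]
      congr 1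
      -- Moving `h` past `y^(j-1-l)` contributes `χ(h)^(j-1-l)`, which reduces the twist
      -- `χ(h)^{-(j-1)}` of `q` to the required `χ(h)^{-l}`.
      have hl : j - 1 = (j - 1 - l) + l := by omega
      conv_lhs => enter [2]; rw [hl]
      rw [pow_add, ← mul_assoc, ← mul_pow, mul_inv_cancel₀ (Units.ne_zero _), one_pow, one_mul])
    (fun x => M_ext fun l => by
      rw [coords_y_smul]
      simp only [LinearMap.comp_apply, LinearEquiv.coe_coe, LinearEquiv.apply_symm_apply,
        LinearMap.pi_apply, Algebra.lsmul_coe]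
      rw [← mul_smul, ← pow_succ]
      split_ifs with h
      · rw [h, Nat.sub_zero, Nat.sub_add_cancel (by omega), hy, map_zero]
      · congr 3
        omega)

theorem coords_toM (q : X →ₗ[k] V)
    (hq : ∀ h x, q (D.ofG h • x) = ((D.χ h : k)⁻¹ ^ (j - 1)) • ρ h (q x))
    (hy : ∀ x : X, D.y ^ j • x = 0) (x : X) (l : Fin j) :
    D.coords hD ρ hj (toM hD ρ hj q hq hy x) l = q (D.y ^ (j - 1 - l) • x) := rfl

end maps

end GroupDatum

/-! ### Twisting by a linear character -/

namespace Representation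

variable {k : Type*} {G : Type*} {V W : Type*} [Field k] [Group G]
  [AddCommGroup V] [Module k V] [AddCommGroup W] [Module k W]

/-- The twist of a representation by a linear character. -/
def twist (ψ : G →* kˣ) (ρ : Representation k G V) : Representation k G V where
  toFun h := (ψ h : k) • ρ h
  map_one' := by simp
  map_mul' a b := by ext; simp [smul_smul, mul_comm]

@[simp]
theorem twist_apply (ψ : G →* kˣ) (ρ : Representation k G V) (h : G) (v : V) :
    ρ.twist ψ h v = (ψ h : k) • ρ h v := rfl

theorem IsIrreducible.twist {ρ : Representation k G V} (hρ : ρ.IsIrreducible) (ψ : G →* kˣ) :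
    (ρ.twist ψ).IsIrreducible :=
  hρ.of_equivariant (LinearEquiv.refl k V) (fun h => ((ψ h)⁻¹ : kˣ)) fun h v => by
    simp [smul_smul]

theorem nonempty_linearCharacterRep_tprod_equiv_iff (ψ : G →* kˣ) (ρ : Representation k G V)
    (σ : Representation k G W) :
    Nonempty (((linearCharacterRep ψ).tprod ρ).Equiv σ) ↔
      ∃ e : V ≃ₗ[k] W, ∀ h v, e ((ψ h : k) • ρ h v) = σ h (e v) := by
  constructor
  · rintro ⟨e⟩
    refine ⟨(_root_.TensorProduct.lid k V).symm.trans e.toLinearEquiv, fun h v => ?_⟩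
    rw [LinearEquiv.trans_apply, LinearEquiv.trans_apply, ← e.map_apply]
    simp only [_root_.TensorProduct.lid_symm_apply, tprod_apply, TensorProduct.map_tmul,
      linearCharacterRep, MonoidHom.coe_mk, OneHom.coe_mk, LinearMap.smul_apply, LinearMap.id_apply]
    rw [TensorProduct.tmul_smul, TensorProduct.smul_tmul']
  · rintro ⟨e, he⟩
    refine nonempty_equiv_of ((_root_.TensorProduct.lid k V).trans e) fun h x => ?_
    induction x using TensorProduct.induction_on with
    | zero => simp
    | tmul c v => simp [linearCharacterRep, ← he, smul_smul, mul_comm]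
    | add x y hx hy => simp only [map_add, hx, hy]

theorem nonempty_tprod_linearCharacterRep_equiv (ψ : G →* kˣ) (ρ : Representation k G V)
    (σ : Representation k G W) (e : V ≃ₗ[k] W) (he : ∀ h v, e ((ψ h : k) • ρ h v) = σ h (e v)) :
    Nonempty ((ρ.tprod (linearCharacterRep ψ)).Equiv σ) := by
  refine nonempty_equiv_of ((_root_.TensorProduct.rid k V).trans e) fun h x => ?_
  induction x using TensorProduct.induction_on with
  | zero => simp
  | tmul v c => simp [linearCharacterRep, ← he, smul_smul, mul_comm]
  | add x y hx hy => simp only [map_add, hx, hy]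

end Representation

namespace GroupDatum

variable {k : Type u} {G : Type v} [Field k] [Group G] {D : GroupDatum k G}

/-! ### Projectivity of `M(V, n)` and projective covers -/

section cover

variable {hD : D.IsNilpotentType} {V : Type*} [AddCommGroup V] [Module k V]
  {ρ : Representation k G V} {j : ℕ} {hj : j ≤ D.n}

variable (D hD ρ hj) in
/-- The inclusion of `V` into `M(V, j)` in degree zero. -/
noncomputable def bottom (h1 : 1 ≤ j) : V →ₗ[k] D.M hD ρ j hj :=
  (D.coords hD ρ hj).symm.toLinearMap ∘ₗ LinearMap.single k (fun _ => V) ⟨0, h1⟩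

theorem coords_bottom (h1 : 1 ≤ j) (v : V) :
    D.coords hD ρ hj (bottom D hD ρ hj h1 v) = Pi.single ⟨0, h1⟩ v :=
  LinearEquiv.apply_symm_apply _ _

theorem bottom_equivariant (h1 : 1 ≤ j) (h : G) (v : V) :
    bottom D hD ρ hj h1 (ρ h v) = D.ofG h • bottom D hD ρ hj h1 v := by
  refine M_ext fun l => ?_
  rw [coords_ofG_smul, coords_bottom, coords_bottom]
  by_cases hl : l = ⟨0, h1⟩
  · subst hl
    simp
  · simp [hl]

theorem sum_y_pow_smul_bottom (h1 : 1 ≤ j) (f : D.M hD ρ j hj) :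
    ∑ l : Fin j, D.y ^ (l : ℕ) • bottom D hD ρ hj h1 (D.coords hD ρ hj f l) = f := by
  refine M_ext fun a => ?_
  rw [map_sum, Finset.sum_apply, Finset.sum_eq_single a]
  · rw [coords_y_pow_smul, dif_neg (lt_irrefl _), coords_bottom]
    simp
  · intro l _ hla
    rw [coords_y_pow_smul, coords_bottom]
    split_ifs with h
    · rfl
    · refine Pi.single_eq_of_ne (fun h0 => hla ?_) _
      have := congrArg Fin.val h0
      exact Fin.ext (by dsimp only at this; omega)
  · simp

/-- An averaged linear section lifts the degree zero copy of `V` equivariantly. It extends to all of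
`M(V, n)` because `y^n = 0` in `H_D`. -/
theorem exists_rightInverse_of_surjective_to_M [Finite G] [CharZero k] (hn : 2 ≤ D.n)
    {X : Type*} [AddCommGroup X] [Module k X] [Module D.H X] [IsScalarTower k D.H X]
    (p : X →ₗ[D.H] D.M hD ρ D.n le_rfl) (hp : Function.Surjective p) :
    ∃ s : D.M hD ρ D.n le_rfl →ₗ[D.H] X, ∀ f, p (s f) = f := by
  have := Fintype.ofFinite G
  obtain ⟨s₀, hs₀⟩ := (p.restrictScalars k).exists_rightInverse_of_surjective
    (LinearMap.range_eq_top.2 hp)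
  let b := bottom D hD ρ le_rfl (by omega : 1 ≤ D.n)
  let s := Representation.average ρ (D.restrictRep X) (s₀ ∘ₗ b)
  have hs (h : G) (v : V) : s (ρ h v) = D.ofG h • s v :=
    Representation.average_equivariant _ _ _ h v
  have hps (v : V) : p (s v) = b v :=
    Representation.comp_average_eq ρ (D.restrictRep X)
      (τ := D.restrictRep (D.M hD ρ D.n le_rfl)) (p := p.restrictScalars k)
      (fun a w => p.map_smul _ w) (bottom_equivariant _)
      (fun v => LinearMap.congr_fun hs₀ (b v)) v
  refine ⟨fromM hD le_rfl s hs fun v => by rw [hD.y_pow, zero_smul], fun f => ?_⟩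
  rw [fromM_apply, map_sum]
  simp only [map_smul, hps]
  exact sum_y_pow_smul_bottom _ f

theorem M_projective [Finite G] [CharZero k] (hn : 2 ≤ D.n) :
    Module.Projective D.H (D.M hD ρ D.n le_rfl) := by
  obtain ⟨s, hs⟩ := exists_rightInverse_of_surjective_to_M (X := D.M hD ρ D.n le_rfl →₀ D.H) hn
    (Finsupp.linearCombination D.H id) (Finsupp.linearCombination_id_surjective _ _)
  exact ⟨s, hs⟩

theorem exists_isProjectiveCover [Finite G] [CharZero k] (hn : 2 ≤ D.n)
    (hρ : ρ.IsIrreducible) (h1 : 1 ≤ j) :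
    ∃ π : D.M hD ρ D.n le_rfl →ₗ[D.H] D.M hD ρ j hj, IsProjectiveCover π := by
  have := ((Representation.isIrreducible_iff_invariant ρ).1 hρ).1
  have := M_nontrivial (D := D) (hD := hD) (ρ := ρ) (hj := hj) h1
  have hn1 : 1 ≤ D.n := by omega
  let π := fromM hD le_rfl (bottom D hD ρ hj h1) (bottom_equivariant h1)
    fun v => by rw [hD.y_pow, zero_smul]
  have hb (v : V) : π (bottom D hD ρ le_rfl hn1 v) = bottom D hD ρ hj h1 v := by
    rw [fromM_apply, coords_bottom, Finset.sum_eq_single ⟨0, hn1⟩]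
    · simp
    · intro l _ hl
      rw [Pi.single_eq_of_ne hl, map_zero, smul_zero]
    · simp
  have hsurj : Function.Surjective π := fun z => by
    rw [← LinearMap.mem_range, ← sum_y_pow_smul_bottom h1 z]
    exact sum_mem fun l _ => Submodule.smul_mem _ _ ⟨_, hb _⟩
  refine ⟨π, M_projective hn, hsurj, fun N hN => ?_⟩
  -- In a uniserial module every proper submodule, here the kernel, is superfluous.
  rcases M_isUniserial hρ N (LinearMap.ker π) with h | h
  · rw [sup_eq_right.2 h, LinearMap.ker_eq_top] at hN
    obtain ⟨z, hz⟩ := exists_ne (0 : D.M hD ρ j hj)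
    obtain ⟨f, rfl⟩ := hsurj z
    exact absurd (by rw [hN]; rfl) hz
  · rwa [sup_eq_left.2 h] at hN

end cover

/-! ### Classification of indecomposable modules -/

section classification

variable {ι : Type*} {V : ι → Type w} [∀ i, AddCommGroup (V i)] [∀ i, Module k (V i)]
  {ρ : ∀ i, Representation k G (V i)}

/-- A copy of `M(V_i, t)` of maximal length `t` in `X` is a direct summand. Only the summand has to
be finite-dimensional, so no finiteness of `X` enters. -/
theorem exists_equiv_M [Finite G] [CharZero k] (hD : D.IsNilpotentType)
    (hirr : ∀ i, (ρ i).IsIrreducible)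
    (hcomplete : ∀ (W : Type u) [AddCommGroup W] [Module k W] (σ : Representation k G W),
      σ.IsIrreducible → ∃ i, Nonempty (σ.Equiv (ρ i)))
    {X : Type*} [AddCommGroup X] [Module k X] [Module D.H X] [IsScalarTower k D.H X]
    (hX : IsIndecomposableModule D.H X) :
    ∃ i j, ∃ hj : j ≤ D.n, 1 ≤ j ∧ Nonempty (X ≃ₗ[D.H] D.M hD (ρ i) j hj) := by
  classical
  have := Fintype.ofFinite G
  have hXn := hX.1
  have hex : ∃ t, ∀ x : X, D.y ^ t • x = 0 := ⟨D.n, fun x => by rw [hD.y_pow, zero_smul]⟩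
  obtain ⟨t, ht, htmin, htn⟩ : ∃ t, (∀ x : X, D.y ^ t • x = 0) ∧
      (∀ s < t, ¬ ∀ x : X, D.y ^ s • x = 0) ∧ t ≤ D.n :=
    ⟨Nat.find hex, Nat.find_spec hex, fun s => Nat.find_min hex,
      Nat.find_min' hex fun x => by rw [hD.y_pow, zero_smul]⟩
  have ht1 : 1 ≤ t := by
    rw [Nat.one_le_iff_ne_zero]
    rintro rfl
    obtain ⟨x, hx⟩ := exists_ne (0 : X)
    exact hx (by simpa using ht x)
  let K : Submodule k X := LinearMap.ker (Algebra.lsmul k k X (D.y ^ (t - 1)))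
  have hK : K ≠ ⊤ := fun h => htmin (t - 1) (by omega) fun x =>
    (by rw [h]; trivial : x ∈ K)
  obtain ⟨i, s, hs, hsK⟩ := Representation.exists_equivariant_notMem hcomplete
    (D.restrictRep X) (K := K) (fun h x hx => by
      change D.y ^ (t - 1) • D.ofG h • x = 0
      rw [y_pow_smul_ofG_smul, show D.y ^ (t - 1) • x = 0 from hx, smul_zero, smul_zero]) hK
  have := (hirr i).finiteDimensional
  have := ((Representation.isIrreducible_iff_invariant _).1 (hirr i)).1
  have := M_nontrivial (D := D) (hD := hD) (ρ := ρ i) (hj := htn) ht1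
  obtain ⟨L, hL⟩ := (Algebra.lsmul k k X (D.y ^ (t - 1)) ∘ₗ s).exists_leftInverse_of_injective
    ((LinearMap.ker_eq_bot').2 hsK)
  have hL' (v : V i) : L (D.y ^ (t - 1) • s v) = v := LinearMap.congr_fun hL v
  -- On the image of `y^(t-1) ∘ s` the group acts through this twist, so averaging `L` towards `σ`
  -- keeps it a retraction there.
  let σ := (ρ i).twist (D.χ⁻¹ ^ (t - 1))
  have hσ (h : G) (v : V i) : σ h v = ((D.χ h : k)⁻¹ ^ (t - 1)) • ρ i h v := by simp [σ]
  let q := Representation.average (D.restrictRep X) σ L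
  have hq (h : G) (x : X) : q (D.ofG h • x) = ((D.χ h : k)⁻¹ ^ (t - 1)) • ρ i h (q x) :=
    (Representation.average_equivariant (D.restrictRep X) σ L h x).trans (hσ h _)
  have hqs (v : V i) : q (D.y ^ (t - 1) • s v) = v := by
    refine Representation.average_apply_eq _ _ fun a => ?_
    have h1 := hL' (ρ i a v)
    rw [hs, restrictRep_apply, y_pow_smul_ofG_smul, map_smul] at h1
    rw [hσ, ← h1, smul_smul, ← mul_pow, inv_mul_cancel₀ (Units.ne_zero _), one_pow, one_smul,
      restrictRep_apply]
  let Φ := toM hD (ρ i) htn q hq ht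
  let Ψ := fromM hD htn s hs fun v => ht _
  have hinj : Function.Injective (Φ ∘ₗ Ψ) := by
    rw [← LinearMap.ker_eq_bot, LinearMap.ker_eq_bot']
    intro f hf
    -- Degree `a` of `Φ (Ψ f)` is the sum over `l` of `q (y^(t-1-a+l) s(f_l))`. Terms with `l < a`
    -- vanish by induction and those with `l > a` since `y^t = 0` on `X`; the term `l = a` is `f_a`.
    have hcoord (a : ℕ) : ∀ ha : a < t, D.coords hD (ρ i) htn f ⟨a, ha⟩ = 0 := by
      induction a using Nat.strong_induction_on with
      | _ a ih =>
        intro ha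
        have h1 : D.coords hD (ρ i) htn (Φ (Ψ f)) ⟨a, ha⟩ = 0 := by
          rw [show Φ (Ψ f) = 0 from hf, map_zero, Pi.zero_apply]
        rw [coords_toM, show Ψ f = _ from fromM_apply _ _ _ f, Finset.smul_sum, map_sum,
          Finset.sum_eq_single ⟨a, ha⟩] at h1
        · rw [← mul_smul, ← pow_add] at h1
          rw [← hqs (D.coords hD (ρ i) htn f ⟨a, ha⟩), ← h1]
          congr 3
          dsimp only
          omega
        · intro l _ hl
          rcases lt_or_ge (l : ℕ) a with hla | hla
          · rw [ih l hla l.2, map_zero, smul_zero, smul_zero, map_zero]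
          · have hla' : a ≠ l := fun h => hl (Fin.ext h.symm)
            have hexp : t - 1 - a + l = (t - 1 - a + l - t) + t := by omega
            rw [← mul_smul, ← pow_add, hexp, pow_add, mul_smul, ht, smul_zero, map_zero]
        · simp
    exact M_ext fun l => by rw [hcoord l l.2, map_zero, Pi.zero_apply]
  have hfin : FiniteDimensional k (D.M hD (ρ i) t htn) :=
    (D.coords hD (ρ i) htn).symm.finiteDimensional
  have hsurj : Function.Surjective (Φ ∘ₗ Ψ) :=
    LinearMap.surjective_of_injective (f := (Φ ∘ₗ Ψ).restrictScalars k) hinj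
  -- As `Φ ∘ Ψ` is bijective, `X` is the direct sum of the image of `Ψ` and the kernel of `Φ`.
  have hcompl : IsCompl (LinearMap.range Ψ) (LinearMap.ker Φ) := by
    refine IsCompl.of_le ?_ fun x _ => ?_
    · rintro _ ⟨⟨f, rfl⟩, hf⟩
      have : f = 0 := hinj (by rw [map_zero]; exact hf)
      rw [this, map_zero]
      exact zero_mem _
    · obtain ⟨f, hf⟩ := hsurj (Φ x)
      refine Submodule.mem_sup.2 ⟨Ψ f, ⟨f, rfl⟩, x - Ψ f, ?_, by abel⟩
      rw [LinearMap.mem_ker, map_sub, sub_eq_zero]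
      exact hf.symm
  refine ⟨i, t, htn, ht1, ⟨LinearEquiv.ofBijective Φ ⟨?_, fun z => ?_⟩⟩⟩
  · refine LinearMap.ker_eq_bot.1 ((hX.2 _ _ hcompl).resolve_left fun h => ?_)
    rw [LinearMap.range_eq_bot] at h
    obtain ⟨f, hf⟩ := exists_ne (0 : D.M hD (ρ i) t htn)
    exact hf (hinj (by rw [h]; rfl))
  · obtain ⟨f, rfl⟩ := hsurj z
    exact ⟨_, rfl⟩

theorem exists_equiv_M' [Finite G] [CharZero k] (hD : D.IsNilpotentType)
    (hirr : ∀ i, (ρ i).IsIrreducible)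
    (hcomplete : ∀ (W : Type u) [AddCommGroup W] [Module k W] (σ : Representation k G W),
      σ.IsIrreducible → ∃ i, Nonempty (σ.Equiv (ρ i)))
    {X : Type*} [AddCommGroup X] [Module D.H X] (hX : IsIndecomposableModule D.H X) :
    ∃ i j, ∃ hj : j ≤ D.n, 1 ≤ j ∧ Nonempty (X ≃ₗ[D.H] D.M hD (ρ i) j hj) :=
  letI : Module k X := Module.compHom X (algebraMap k D.H)
  haveI : IsScalarTower k D.H X := ⟨fun c a x => by
    rw [Algebra.smul_def, mul_smul]
    rfl⟩
  exists_equiv_M hD hirr hcomplete hX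

theorem _root_.IsUniserialModule.of_equiv {R X Y : Type*} [Ring R] [AddCommGroup X] [Module R X]
    [AddCommGroup Y] [Module R Y] (e : X ≃ₗ[R] Y) (h : IsUniserialModule R Y) :
    IsUniserialModule R X := fun N N' =>
  (h (N.map e.toLinearMap) (N'.map e.toLinearMap)).imp
    (Submodule.map_le_map_iff_of_injective e.injective _ _).1
    (Submodule.map_le_map_iff_of_injective e.injective _ _).1

theorem isNakayamaAlgebra [Finite G] [CharZero k] (hD : D.IsNilpotentType)
    (hirr : ∀ i, (ρ i).IsIrreducible)
    (hcomplete : ∀ (W : Type u) [AddCommGroup W] [Module k W] (σ : Representation k G W),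
      σ.IsIrreducible → ∃ i, Nonempty (σ.Equiv (ρ i))) : IsNakayamaAlgebra k D.H := by
  have key : ∀ (P : Type (max u v)) [AddCommGroup P] [Module D.H P],
      IsIndecomposableModule D.H P → IsUniserialModule D.H P := by
    intro P _ _ hP
    obtain ⟨i, j, hj, -, ⟨e⟩⟩ := exists_equiv_M' hD hirr hcomplete hP
    exact (M_isUniserial (hirr i)).of_equiv e
  exact ⟨D.finiteDimensional_H hD, fun P _ _ _ _ => key P, fun P _ _ _ _ => key P⟩

theorem isFiniteRepresentationType [Finite ι] [Finite G] [CharZero k] (hD : D.IsNilpotentType)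
    (hirr : ∀ i, (ρ i).IsIrreducible)
    (hcomplete : ∀ (W : Type u) [AddCommGroup W] [Module k W] (σ : Representation k G W),
      σ.IsIrreducible → ∃ i, Nonempty (σ.Equiv (ρ i))) : IsFiniteRepresentationType k D.H := by
  classical
  -- The modules `M(V_i, j)` may live in another universe than `H_D`. Each pair is therefore
  -- represented by some isomorphic module in the right universe, or by an arbitrary module if there
  -- is none; the pairs with `j = 0` are harmless.
  let Q (p : ι × Fin (D.n + 1)) (L : ModuleCat.{max u v} D.H) : Prop :=
    Nonempty (L ≃ₗ[D.H] D.M hD (ρ p.1) p.2 (Nat.lt_succ_iff.1 p.2.2))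
  obtain ⟨N, ⟨φ⟩⟩ := Finite.exists_equiv_fin (ι × Fin (D.n + 1))
  refine ⟨D.finiteDimensional_H hD, N, fun s => Classical.epsilon (Q (φ.symm s)), ?_⟩
  intro X _ _ _ hX
  obtain ⟨i, j, hj, -, ⟨e⟩⟩ := exists_equiv_M' hD hirr hcomplete hX
  let p : ι × Fin (D.n + 1) := (i, ⟨j, Nat.lt_succ_iff.2 hj⟩)
  obtain ⟨e'⟩ : Q p (Classical.epsilon (Q p)) :=
    Classical.epsilon_spec (p := Q p) ⟨ModuleCat.of D.H X, ⟨e⟩⟩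
  refine ⟨φ p, ?_⟩
  beta_reduce
  rw [Equiv.symm_apply_apply]
  exact ⟨e.trans e'.symm⟩

/-- Twisting by `χ⁻¹` permutes the isomorphism classes of simple modules. -/
theorem exists_perm_twist [Finite G] [Finite ι] (χ : G →* kˣ) (hirr : ∀ i, (ρ i).IsIrreducible)
    (hnoniso : ∀ i i', Nonempty ((ρ i).Equiv (ρ i')) → i = i')
    (hcomplete : ∀ (W : Type u) [AddCommGroup W] [Module k W] (σ : Representation k G W),
      σ.IsIrreducible → ∃ i, Nonempty (σ.Equiv (ρ i))) :
    ∃ τ : Equiv.Perm ι, ∀ i, ∃ e : V i ≃ₗ[k] V (τ i),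
      ∀ h v, e (ρ i h v) = (χ h : k) • ρ (τ i) h (e v) := by
  have hex (i : ι) : ∃ c, ∃ e : V i ≃ₗ[k] V c,
      ∀ h v, e (ρ i h v) = (χ h : k) • ρ c h (e v) := by
    obtain ⟨c, e, he⟩ := ((hirr i).twist χ⁻¹).exists_equiv hcomplete
    refine ⟨c, e, fun h v => ?_⟩
    rw [← he, ← map_smul]
    simp [smul_smul]
  choose t ht using hex
  -- Twists cancel: if two simples have isomorphic twists, they are isomorphic. Finiteness of `ι`
  -- upgrades injectivity to bijectivity.
  have hinj : Function.Injective t := by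
    intro i i' h
    have h' := ht i'
    rw [← h] at h'
    obtain ⟨e, he⟩ := ht i
    obtain ⟨e', he'⟩ := h'
    refine hnoniso _ _ (Representation.nonempty_equiv_of (e.trans e'.symm) fun a v => ?_)
    rw [LinearEquiv.trans_apply, LinearEquiv.symm_apply_eq, he', he, LinearEquiv.trans_apply,
      LinearEquiv.apply_symm_apply]
  exact ⟨Equiv.ofBijective t (Finite.injective_iff_bijective.1 hinj), ht⟩

theorem exists_equiv_perm_pow {χ : G →* kˣ} {τ : Equiv.Perm ι}
    (hτ : ∀ i, ∃ e : V i ≃ₗ[k] V (τ i), ∀ h v, e (ρ i h v) = (χ h : k) • ρ (τ i) h (e v))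
    (t : ℕ) (i : ι) : ∃ e : V i ≃ₗ[k] V ((τ ^ t) i),
      ∀ h v, e (ρ i h v) = (χ h : k) ^ t • ρ ((τ ^ t) i) h (e v) := by
  induction t with
  | zero => exact ⟨LinearEquiv.refl k _, fun h v => by rw [pow_zero (χ h : k), one_smul]; rfl⟩
  | succ t ih =>
    obtain ⟨e, he⟩ := ih
    rw [pow_succ', Equiv.Perm.mul_apply]
    obtain ⟨e', he'⟩ := hτ ((τ ^ t) i)
    exact ⟨e.trans e', fun h v => by simp [he, he', smul_smul, pow_succ]⟩

end classification

end GroupDatum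

/-! ### The main theorem -/

theorem mainTheorem2 {k : Type u} [Field k] [IsAlgClosed k] [CharZero k]
    {G : Type v} [Group G] [Finite G]
    (D : GroupDatum k G) (hD : D.IsNilpotentType) (hn : 2 ≤ D.n)
    (m : ℕ) (V : Fin m → Type w) [∀ i, AddCommGroup (V i)] [∀ i, Module k (V i)]
    (ρ : ∀ i, Representation k G (V i))
    (hirr : ∀ i, (ρ i).IsIrreducible)
    (hnoniso : ∀ i i', Nonempty ((ρ i).Equiv (ρ i')) → i = i')
    (hcomplete : ∀ (W : Type u) [AddCommGroup W] [Module k W] (σ : Representation k G W),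
      σ.IsIrreducible → ∃ i, Nonempty (σ.Equiv (ρ i))) :
    ∃ τ : Equiv.Perm (Fin m),
      -- `τ` is the unique permutation with `V_{χ⁻¹} ⊗ V_i ≅ V_i ⊗ V_{χ⁻¹} ≅ V_{τ i}`
      (∀ i, Nonempty (((linearCharacterRep D.χ⁻¹).tprod (ρ i)).Equiv (ρ (τ i))) ∧
        Nonempty (((ρ i).tprod (linearCharacterRep D.χ⁻¹)).Equiv (ρ (τ i)))) ∧
      (∀ τ' : Equiv.Perm (Fin m),
        (∀ i, Nonempty (((linearCharacterRep D.χ⁻¹).tprod (ρ i)).Equiv (ρ (τ' i)))) → τ' = τ) ∧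
      -- `J M` is the radical
      (∀ i j (hj : j ≤ D.n), 1 ≤ j →
        radicalSubmodule D.H (D.M hD (ρ i) j hj) = Module.jacobson D.H (D.M hD (ρ i) j hj)) ∧
      -- (1)
      (∀ i (h1 : 1 ≤ D.n), radicalSubmodule D.H (D.M hD (ρ i) 1 h1) = ⊥) ∧
      (∀ i j (hj : j ≤ D.n), 2 ≤ j →
        Nonempty (radicalSubmodule D.H (D.M hD (ρ i) j hj) ≃ₗ[D.H]
          D.M hD (ρ (τ i)) (j - 1) ((Nat.sub_le j 1).trans hj))) ∧
      -- (2)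
      (∀ i j (hj : j ≤ D.n), 1 ≤ j →
        Nonempty (socleSubmodule D.H (D.M hD (ρ i) j hj) ≃ₗ[D.H]
          D.Infl hD hn (ρ ((τ ^ (j - 1)) i))) ∧
        Nonempty ((D.M hD (ρ i) j hj ⧸ radicalSubmodule D.H (D.M hD (ρ i) j hj)) ≃ₗ[D.H]
          D.Infl hD hn (ρ i)) ∧
        ∃ π : D.M hD (ρ i) D.n le_rfl →ₗ[D.H] D.M hD (ρ i) j hj, IsProjectiveCover π) ∧
      -- (3)
      (∀ i j (hj : j ≤ D.n), 1 ≤ j →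
        FiniteDimensional k (D.M hD (ρ i) j hj) ∧
        IsIndecomposableModule D.H (D.M hD (ρ i) j hj) ∧
        IsUniserialModule D.H (D.M hD (ρ i) j hj)) ∧
      IsNakayamaAlgebra k D.H ∧
      IsFiniteRepresentationType k D.H ∧
      -- (4)
      (∀ i i' j j' (hj : j ≤ D.n) (hj' : j' ≤ D.n), 1 ≤ j → 1 ≤ j' →
        (Nonempty (D.M hD (ρ i) j hj ≃ₗ[D.H] D.M hD (ρ i') j' hj') ↔ i = i' ∧ j = j')) ∧
      (∀ (X : Type*) [AddCommGroup X] [Module k X] [Module D.H X] [IsScalarTower k D.H X],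
        FiniteDimensional k X → IsIndecomposableModule D.H X →
        ∃ i j, ∃ hj : j ≤ D.n, 1 ≤ j ∧ Nonempty (X ≃ₗ[D.H] D.M hD (ρ i) j hj)) := by
  obtain ⟨τ, hτ⟩ := GroupDatum.exists_perm_twist D.χ hirr hnoniso hcomplete
  have hτ' (i : Fin m) : ∃ e : V i ≃ₗ[k] V (τ i),
      ∀ h v, e ((D.χ⁻¹ h : kˣ) • ρ i h v) = ρ (τ i) h (e v) := by
    obtain ⟨e, he⟩ := hτ i
    exact ⟨e, fun h v => by simp [Units.smul_def, he, smul_smul]⟩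
  refine ⟨τ, fun i => ?_, fun τ' hτ'' => Equiv.ext fun i => ?_, fun i j hj h1 => ?_,
    fun i h1 => ?_, fun i j hj h2 => ?_, fun i j hj h1 => ⟨?_, ?_, ?_⟩,
    fun i j hj h1 => ⟨?_, GroupDatum.M_isIndecomposable (hirr i) h1,
      GroupDatum.M_isUniserial (hirr i)⟩,
    GroupDatum.isNakayamaAlgebra hD hirr hcomplete,
    GroupDatum.isFiniteRepresentationType hD hirr hcomplete,
    fun i i' j j' hj hj' h1 h1' => ⟨fun ⟨E⟩ => ?_, ?_⟩,
    fun X _ _ _ _ _ hX => GroupDatum.exists_equiv_M hD hirr hcomplete hX⟩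
  · obtain ⟨e, he⟩ := hτ' i
    exact ⟨(Representation.nonempty_linearCharacterRep_tprod_equiv_iff _ _ _).2 ⟨e, he⟩,
      Representation.nonempty_tprod_linearCharacterRep_equiv _ _ _ e he⟩
  · obtain ⟨e, he⟩ := hτ' i
    obtain ⟨e', he'⟩ :=
      (Representation.nonempty_linearCharacterRep_tprod_equiv_iff _ _ _).1 (hτ'' i)
    -- Both `V_{τ' i}` and `V_{τ i}` are isomorphic to the twist of `V_i` by `χ⁻¹`.
    refine hnoniso _ _ (Representation.nonempty_equiv_of (e'.symm.trans e) fun h v => ?_)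
    obtain ⟨v, rfl⟩ := e'.surjective v
    rw [LinearEquiv.trans_apply, LinearEquiv.trans_apply, ← he', LinearEquiv.symm_apply_apply,
      LinearEquiv.symm_apply_apply, ← he]
    rfl
  · rw [GroupDatum.radical_eq_filtration_one (hirr i) h1,
      GroupDatum.jacobson_eq_filtration_one (hirr i) h1]
  · rw [GroupDatum.radical_eq_filtration_one (hirr i) le_rfl, GroupDatum.filtration_self]
  · obtain ⟨e, he⟩ := hτ i
    rw [GroupDatum.radical_eq_filtration_one (hirr i) (by omega)]
    exact GroupDatum.nonempty_filtration_equiv_M 1 e (fun h v => by rw [he, pow_one]) (by omega)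
  · obtain ⟨e, he⟩ := GroupDatum.exists_equiv_perm_pow hτ (j - 1) i
    rw [GroupDatum.socle_eq_filtration (hirr i) h1]
    exact GroupDatum.nonempty_filtration_equiv_Infl hn h1 e he
  · rw [GroupDatum.radical_eq_filtration_one (hirr i) h1]
    exact GroupDatum.nonempty_quotient_filtration_one_equiv D (ρ i) hD hj hn h1
  · exact GroupDatum.exists_isProjectiveCover hn (hirr i) h1
  · have := (hirr i).finiteDimensional
    exact (D.coords hD (ρ i) hj).symm.finiteDimensional
  · obtain ⟨h, hjj⟩ := GroupDatum.eq_of_M_equiv hn (hirr i) (hirr i') h1 h1' E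
    exact ⟨hnoniso _ _ h, hjj⟩
  · rintro ⟨rfl, rfl⟩
    exact ⟨LinearEquiv.refl _ _⟩
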